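/- Let $k_1,\dots,k_L$ be loop momenta, $p_1,\dots,p_E\in\mathbb R^{1,n}$ external momenta (real Minkowski vectors, metric $(+,-,\dots,-)$, $n$ arbitrary), $m_1,\dots,m_P\in\mathbb R$ masses, $q_j=\sum_l a_{jl}k_l+\sum_e b_{je}p_e$ with real coefficients $a_{jl},b_{je}$, $\nu\in\mathbb Z^P$, $\varepsilon>0$, and let $$F_I=\frac{\mathcal N(\{k_l\cdot k_{l'}\},\{k_l\cdot p_e\};D)}{\prod_{j=1}^P(m_j^2-q_j^2-i\varepsilon)^{\nu_j}},$$ where $\mathcal N$ is a polynomial in the indicated products whose coefficients may depend on $D$. Let $S\subseteq\{1,\dots,L\}$ and $i\in S$. The momenta $k_l$ with $l\in S$ are integrated over and those with $l\notin S$ are held fixed in $\mathbb R^{1,n}$; $S=\{i\}$ gives the integral over the single momentum $k_i$, and $S=\{1,\dots,L\}$ the integral over all loop momenta. Then, in dimensional regularisation, $$\int\prod_{l\in S}\mathrm d^Dk_l\;\frac{\partial}{\partial k_i^\mu}\bigl[v^\mu F_I\bigr]=0$$ as a meromorphic function of $D\in\mathbb C$, for every $D$-dimensional vector $v=\sum_{l\in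 S}c_l k_l+w$, $w\in\mathbb R^{1,n}\otimes\mathbb C$, where the coefficients $c_l$ and the components of $w$ are constants or, more generally, polynomials with complex coefficients in the $k_l\cdot k_{l'}$ and the components of the $k_l$ along $\mathbb R^{1,n}$ ($l,l'\in S$). (In particular $v$ may be any vector independent of $k_i$, or $v=k_i$.) This holds for every $\varepsilon>0$, hence also in the limit $\varepsilon\to0^+$. Here the derivative is expanded by the product and chain rules with $\partial k_l^\mu/\partial k_i^\mu=D\,\delta_{il}$, which gives a finite sum of terms $N/\prod_jX_j^{\nu_j}$, where $X_j=m_j^2-q_j^2-i\varepsilon$ and $N$ is a polynomial in the $k_l\cdot k_{l'}$ and the components of the $k_l$ along $\mathbb R^{1,n}$. The dimensionally regularised integral of such a sum is the meromorphic function of $D\in\mathbb C$ (with removable singularities removed) that for all sufficiently negative $\operatorname{Re}D$ equals the sum over the terms of the absolutely convergent Schwinger parametric integrals $$\prod_{\nu_j>0}\frac{i^{\nu_j}}{\Gamma(\nu_j)}\int_0^\infty\mathrm d\alpha_j\,\alpha_j^{\nu_j-1}\;\int\prod_{l\in S}\mathrm d^Dk_l\;\Bigl(N\prod_{\nu_j\le0}X_j^{-\nu_j}\Bigr)e^{-i\sum_{\nu_j>0}\alpha_jX_j};$$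 the assertion includes that these integrals converge. The inner $D$-dimensional Gaussian integral of a polynomial $f$ is as follows. Put $A_{ll'}=\sum_{\nu_j>0}\alpha_ja_{jl}a_{jl'}$ for $l,l'\in S$, let $r_j$ be the part of $q_j$ that does not contain the integrated momenta, and put $b_l=\sum_{\nu_j>0}\alpha_ja_{jl}r_j$ and $\kappa=-A^{-1}b$. The integral is $$\bigl(i\pi^{D/2}e^{-i\pi D/4}\bigr)^{|S|}(\det A)^{-D/2}\,e^{-i\sum_{\nu_j>0}\alpha_j(m_j^2-r_j^2-i\varepsilon)-i\sum_{l,l'}(A^{-1})_{ll'}\,b_l\cdot b_{l'}}\Bigl[e^{\frac i4\sum_{l,l'}(A^{-1})_{ll'}\,\partial_{k_l}\cdot\,\partial_{k_{l'}}}f\Bigr]_{k=\kappa},$$ and it is $0$ if $\det A=0$. -/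

import Mathlib

noncomputable section

namespace DimReg

/-- The diagonal entries `(1, -1, …, -1)` of the Minkowski metric on `ℝ^{1,n}`. -/
def metric {n : ℕ} (μ : Fin (n + 1)) : ℝ := if μ = 0 then 1 else -1

/-- Vectors of `ℝ^{1,n}`. All the momenta that are held fixed (and all the fixed auxiliary
vectors) span a finite-dimensional space, which is contained in `ℝ^{1,n}` for some `n`. -/
abbrev Mink (n : ℕ) : Type := Fin (n + 1) → ℝ

/-- The Minkowski product. -/
def mdot {n : ℕ} (x y : Mink n) : ℝ := ∑ μ, metric μ * x μ * y μ

theorem mdot_comm {n : ℕ} (x y : Mink n) : mdot x y = mdot y x :=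
  Finset.sum_congr rfl fun μ _ => by ring

/-! ### Vector calculus in `D` dimensions

`ι` indexes the momenta that are integrated over. Their `D`-dimensional space is thought of as
`ℝ^{1,n}` plus an orthogonal complement of dimension `D - n - 1`. -/

/-- The scalars on which an integrand may depend: the products `k_l · k_{l'}` and the
components `k_l^μ` along `ℝ^{1,n}` (hence all `k_l · w` with `w` in `ℝ^{1,n}`). -/
abbrev ScalarVar (ι : Type) (n : ℕ) : Type := Sym2 ι ⊕ ι × Fin (n + 1)

/-- Polynomial scalar functions of the integrated momenta. -/
abbrev Scalar (ι : Type) (n : ℕ) : Type := MvPolynomial (ScalarVar ι n) ℂ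

/-- A `D`-dimensional vector `v = ∑_l loop_l k_l + ∑_μ par_μ e_μ`; its coefficients may depend
polynomially on the integrated momenta. -/
structure Vec (ι : Type) (n : ℕ) where
  /-- coefficients of the integrated momenta -/
  loop : ι → Scalar ι n
  /-- coefficients of the standard basis of `ℝ^{1,n}` -/
  par : Fin (n + 1) → Scalar ι n

section Calculus

variable {ι : Type} [Fintype ι] {n : ℕ}

/-- A fixed vector of `ℝ^{1,n}`. -/
def constVec (x : Mink n) : Vec ι n := ⟨0, fun μ => MvPolynomial.C (x μ : ℂ)⟩

/-- The product `v · w`. -/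
def dot (v w : Vec ι n) : Scalar ι n :=
  (∑ l, ∑ l', v.loop l * w.loop l' * MvPolynomial.X (Sum.inl s(l, l')))
    + (∑ l, ∑ μ, MvPolynomial.C (metric μ : ℂ) *
        (v.loop l * w.par μ + w.loop l * v.par μ) * MvPolynomial.X (Sum.inr (l, μ)))
    + ∑ μ, MvPolynomial.C (metric μ : ℂ) * v.par μ * w.par μ

theorem dot_comm (v w : Vec ι n) : dot v w = dot w v := by
  have h1 : (∑ l, ∑ l', v.loop l * w.loop l' * (MvPolynomial.X (Sum.inl s(l, l')) : Scalar ι n))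
      = ∑ l, ∑ l', w.loop l * v.loop l' * MvPolynomial.X (Sum.inl s(l, l')) := by
    rw [Finset.sum_comm]
    refine Finset.sum_congr rfl fun l _ => Finset.sum_congr rfl fun l' _ => ?_
    rw [Sym2.eq_swap, mul_comm (v.loop l')]
  have h2 : (∑ l, ∑ μ, MvPolynomial.C (metric μ : ℂ) *
        (v.loop l * w.par μ + w.loop l * v.par μ) *
          (MvPolynomial.X (Sum.inr (l, μ)) : Scalar ι n))
      = ∑ l, ∑ μ, MvPolynomial.C (metric μ : ℂ) *
        (w.loop l * v.par μ + v.loop l * w.par μ) * MvPolynomial.X (Sum.inr (l, μ)) :=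
    Finset.sum_congr rfl fun l _ => Finset.sum_congr rfl fun μ _ => by
      rw [add_comm (v.loop l * w.par μ)]
  have h3 : (∑ μ, MvPolynomial.C (metric μ : ℂ) * v.par μ * w.par μ : Scalar ι n)
      = ∑ μ, MvPolynomial.C (metric μ : ℂ) * w.par μ * v.par μ :=
    Finset.sum_congr rfl fun μ _ => mul_right_comm _ _ _
  rw [dot, dot, h1, h2, h3]

variable [DecidableEq ι]

/-- The integrated momentum `k_l`. -/
def loopVec (l : ι) : Vec ι n := ⟨Pi.single l 1, 0⟩

/-- The gradient of `f` with respect to `k_i`, from `∂(k_i · k_l) = k_l` for `l ≠ i`,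
`∂(k_i · k_i) = 2 k_i` and the chain rule. -/
def grad (i : ι) (f : Scalar ι n) : Vec ι n where
  loop l := (if l = i then 2 else 1) * MvPolynomial.pderiv (Sum.inl s(i, l)) f
  par μ := MvPolynomial.C (metric μ : ℂ) * MvPolynomial.pderiv (Sum.inr (i, μ)) f

/-- The directional derivative `v^μ ∂f/∂k_i^μ`. -/
def dirDeriv (i : ι) (v : Vec ι n) (f : Scalar ι n) : Scalar ι n := dot v (grad i f)

/-- The divergence `∂v^μ/∂k_i^μ` in `D` dimensions, by the product rule and
`∂k_l^μ/∂k_i^μ = D δ_{il}`. -/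
def divergence (D : ℂ) (i : ι) (v : Vec ι n) : Scalar ι n :=
  MvPolynomial.C D * v.loop i + (∑ l, dirDeriv i (loopVec l) (v.loop l))
    + ∑ μ, dirDeriv i (constVec (Pi.single μ 1)) (v.par μ)

end Calculus

/-! ### Propagators and integrands -/

/-- `P` propagators with momenta `q_j = ∑_l coeff_{jl} k_l + shift_j`, where the sum is over the
integrated momenta, and with squared masses `massSq_j`. -/
structure Propagators (ι : Type) (P n : ℕ) where
  /-- coefficients of the integrated momenta -/
  coeff : Fin P → ι → ℝ
  /-- the part of the momentum that is held fixed -/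
  shift : Fin P → Mink n
  /-- squared masses -/
  massSq : Fin P → ℝ

/-- Formal finite sums of the integrands `N / ∏_j (m_j^2 - q_j^2 - iε)^{ν_j}`, encoded as
`ν ↦ N`. -/
abbrev Integrand (ι : Type) (P n : ℕ) : Type := (Fin P → ℤ) →₀ Scalar ι n

namespace Propagators

variable {ι : Type} [Fintype ι] [DecidableEq ι] {P n : ℕ} (Φ : Propagators ι P n)

/-- The momentum `q_j`. -/
def momentum (j : Fin P) : Vec ι n where
  loop l := MvPolynomial.C (Φ.coeff j l : ℂ)
  par μ := MvPolynomial.C (Φ.shift j μ : ℂ)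

/-- The denominator `m_j^2 - q_j^2 - iε`. -/
def denom (ε : ℝ) (j : Fin P) : Scalar ι n :=
  MvPolynomial.C ((Φ.massSq j : ℂ) - Complex.I * ε) - dot (Φ.momentum j) (Φ.momentum j)

/-- The total derivative `∂/∂k_i^μ [v^μ N / ∏_j (m_j^2 - q_j^2 - iε)^{ν_j}]`, expanded by the
product rule. -/
def totalDeriv (ε : ℝ) (D : ℂ) (i : ι) (v : Vec ι n) (N : Scalar ι n) (ν : Fin P → ℤ) :
    Integrand ι P n :=
  Finsupp.single ν (divergence D i v * N + dirDeriv i v N)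
    + ∑ j, Finsupp.single (ν + Pi.single j 1)
        (-(MvPolynomial.C (ν j : ℂ) * N * dirDeriv i v (Φ.denom ε j)))

/-! ### Gaussian integrals in `D` dimensions

`∑_j α_j q_j^2 = ∑_{l,l'} A_{ll'} k_l · k_{l'} + 2 ∑_l b_l · k_l + ∑_j α_j shift_j^2`. -/

/-- The quadratic form `A`; its determinant is the first Symanzik polynomial. -/
def quadMatrix (α : Fin P → ℝ) : Matrix ι ι ℝ :=
  fun l l' => ∑ j, α j * Φ.coeff j l * Φ.coeff j l'

/-- The vectors `b_l`. -/
def linVec (α : Fin P → ℝ) (l : ι) : Mink n := ∑ j, (α j * Φ.coeff j l) • Φ.shift j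

/-- The stationary point `κ = -A⁻¹ b`. -/
def center (α : Fin P → ℝ) (l : ι) : Mink n := -∑ l', (Φ.quadMatrix α)⁻¹ l l' • Φ.linVec α l'

end Propagators

section Wick

variable {ι : Type} [Fintype ι] [DecidableEq ι] {n : ℕ}

/-- The value of `f` at `k_l = κ_l`. -/
def evalAt (κ : ι → Mink n) (f : Scalar ι n) : ℂ :=
  MvPolynomial.eval (Sum.elim
    (Sym2.lift ⟨fun l l' => (mdot (κ l) (κ l') : ℂ), fun l l' =>
      congrArg Complex.ofReal (mdot_comm (κ l) (κ l'))⟩)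
    (fun x => (κ x.1 x.2 : ℂ))) f

/-- The contraction `∑_{l,l'} B_{ll'} ∂_l · ∂_{l'} f` in `D` dimensions. -/
def contraction (D : ℂ) (B : Matrix ι ι ℝ) (f : Scalar ι n) : Scalar ι n :=
  ∑ l, ∑ l', MvPolynomial.C (B l l' : ℂ) * divergence D l (grad l' f)

/-- The mean of `f` with respect to `exp(i ∑ A_{ll'} (k_l - κ_l) · (k_{l'} - κ_{l'}))`, where
`B = A⁻¹`: by Wick's formula it is `exp((i/4) ∑ B_{ll'} ∂_l · ∂_{l'}) f` at `k = κ`. The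
exponential series stops, since a contraction lowers the degree. -/
def wickMean (D : ℂ) (B : Matrix ι ι ℝ) (κ : ι → Mink n) (f : Scalar ι n) : ℂ :=
  ∑ m ∈ Finset.range (f.totalDegree + 1),
    (Complex.I / 4) ^ m / (m.factorial : ℂ) * evalAt κ ((contraction D B)^[m] f)

end Wick

namespace Propagators

variable {ι : Type} [Fintype ι] [DecidableEq ι] {P n : ℕ} (Φ : Propagators ι P n)

/-- The Gaussian integral
`∫ ∏_l d^D k_l  f(k) exp(-i ∑_j α_j (m_j^2 - q_j^2 - iε))`,
with `∫ d^D k exp(i a k^2) = i π^{D/2} e^{-iπD/4} a^{-D/2}` for `a > 0` (there is one time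
direction). -/
def gaussIntegral (ε : ℝ) (D : ℂ) (α : Fin P → ℝ) (f : Scalar ι n) : ℂ :=
  (Complex.I * (Real.pi : ℂ) ^ (D / 2) * Complex.exp (-(Real.pi * Complex.I * D / 4)))
      ^ Fintype.card ι
    * ((Φ.quadMatrix α).det : ℂ) ^ (-D / 2)
    * Complex.exp (-Complex.I * (∑ j, (α j : ℂ) *
          ((Φ.massSq j : ℂ) - mdot (Φ.shift j) (Φ.shift j) - Complex.I * ε))
        - Complex.I * ∑ l, ∑ l',
          ((Φ.quadMatrix α)⁻¹ l l' * mdot (Φ.linVec α l) (Φ.linVec α l') : ℝ))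
    * wickMean D (Φ.quadMatrix α)⁻¹ (Φ.center α) f

/-- The Schwinger parametric integrand of `N / ∏_j (m_j^2 - q_j^2 - iε)^{ν_j}`. There is one
parameter for each `j` with `ν_j > 0`, from
`X^{-ν} = i^ν / Γ(ν) ∫_0^∞ dα α^{ν-1} e^{-iαX}` for `Im X < 0`;
factors with `ν_j ≤ 0` are polynomials and belong to the numerator. -/
def schwinger (ε : ℝ) (D : ℂ) (ν : Fin P → ℤ) (N : Scalar ι n)
    (α : {j : Fin P // 0 < ν j} → ℝ) : ℂ :=
  (∏ j, Complex.I ^ ν j.1 * (α j : ℂ) ^ (ν j.1 - 1) / Complex.Gamma (ν j.1 : ℂ))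
    * Φ.gaussIntegral ε D (fun j => if h : 0 < ν j then α ⟨j, h⟩ else 0)
        (N * ∏ j, if 0 < ν j then 1 else Φ.denom ε j ^ (-ν j).toNat)

/-- `G` is the dimensionally regulated integral over all `k_l`, `l : ι`, with measure
`∏_l d^D k_l`, of the integrand `T D`: a meromorphic function of `D` on the whole plane
(normalised at removable singularities) which is given by the absolutely convergent parametric
integral when `Re D` is sufficiently negative. -/
def IsDimRegIntegral (ε : ℝ) (T : ℂ → Integrand ι P n) (G : ℂ → ℂ) : Prop :=
  MeromorphicNFOn G Set.univ ∧
    ∃ c : ℝ, ∀ D : ℂ, D.re < c →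
      (∀ ν ∈ (T D).support, MeasureTheory.IntegrableOn
        (Φ.schwinger ε D ν (T D ν)) {α | ∀ j, 0 < α j}) ∧
      G D = (T D).sum fun ν N => ∫ α in {α | ∀ j, 0 < α j}, Φ.schwinger ε D ν N α

end Propagators

/-! ### Feynman integrands -/

/-- A Feynman integrand with loop momenta `k_1, …, k_L`, external momenta `p_1, …, p_E` and `P`
propagators of momenta `q_j = ∑_l a_{jl} k_l + ∑_e b_{je} p_e`. -/
structure FeynmanIntegrand (L E P n : ℕ) where
  /-- external momenta -/
  ext : Fin E → Mink n
  /-- propagator masses -/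
  mass : Fin P → ℝ
  /-- coefficients of the loop momenta -/
  loopCoeff : Fin P → Fin L → ℝ
  /-- coefficients of the external momenta -/
  extCoeff : Fin P → Fin E → ℝ
  /-- the propagator exponents -/
  exponent : Fin P → ℤ
  /-- the numerator, a polynomial in the `k_l · k_{l'}` and the `k_l · p_e` whose coefficients
  are functions of `D` -/
  numerator : MvPolynomial (Sym2 (Fin L) ⊕ Fin L × Fin E) (ℂ → ℂ)

namespace FeynmanIntegrand

variable {L E P n : ℕ} (F : FeynmanIntegrand L E P n) (S : Finset (Fin L)) (k : Fin L → Mink n)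

/-- The propagators, when the loop momenta in `S` are integrated over and the others have the
fixed values `k`. -/
def propagators : Propagators S P n where
  coeff j l := F.loopCoeff j l
  shift j := (∑ l ∈ Sᶜ, F.loopCoeff j l • k l) + ∑ e, F.extCoeff j e • F.ext e
  massSq j := F.mass j ^ 2

/-- The loop momentum `k_l`, a variable for `l ∈ S` and fixed otherwise. -/
def loopMomentum (l : Fin L) : Vec S n :=
  if h : l ∈ S then loopVec ⟨l, h⟩ else constVec (k l)

/-- The numerator at the dimension `D`. -/
def numeratorAt (D : ℂ) : Scalar S n :=
  MvPolynomial.aeval (Sum.elim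
    (Sym2.lift ⟨fun l l' => dot (loopMomentum S k l) (loopMomentum S k l'),
      fun _ _ => dot_comm _ _⟩)
    (fun x => dot (loopMomentum S k x.1) (constVec (F.ext x.2))))
    (F.numerator.map (Pi.evalRingHom (fun _ : ℂ => ℂ) D))

end FeynmanIntegrand

end DimReg

end

/-!
For positive Schwinger parameters `α` the integrand of the total derivative vanishes pointwise.
Raising `ν_j` by one multiplies the Schwinger weight by `i α_j / ν_j`, so that differentiating
`X_j ^ (-ν_j)` amounts to differentiating `exp (-i α_j X_j)`, and what remains is the Gaussian
integral of a total derivative. If `det A ≠ 0`, completing the square and commuting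
`∂_a · ∂_b` past one factor `k_l - κ_l` in Wick's formula identify it with zero; if `det A = 0`, the
Gaussian integral is zero by convention.

The integrals converge because a Wick mean is polynomially bounded in `α` up to a pole along
`det A = 0` whose order depends only on the degree: `(det A) ^ (-D/2)` compensates the pole when
`Re D` is sufficiently negative, and `ε > 0` gives exponential decay. The identity theorem for
meromorphic functions then leaves zero as the only value of the regularised integral.
-/

noncomputable section

namespace DimReg

open MvPolynomial

attribute [ext] Vec

namespace Vec

variable {ι : Type} {n : ℕ}

/-- A vector as the pair of its two families of coefficients; the module structure on vectors is
transported along this equivalence. -/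
def equivProd : Vec ι n ≃ (ι → Scalar ι n) × (Fin (n + 1) → Scalar ι n) where
  toFun v := (v.loop, v.par)
  invFun p := ⟨p.1, p.2⟩
  left_inv _ := rfl
  right_inv _ := rfl

instance : AddCommGroup (Vec ι n) := equivProd.addCommGroup

instance : Module (Scalar ι n) (Vec ι n) := equivProd.module (Scalar ι n)

theorem add_loop (v w : Vec ι n) : (v + w).loop = v.loop + w.loop := rfl
theorem add_par (v w : Vec ι n) : (v + w).par = v.par + w.par := rfl
theorem sub_loop (v w : Vec ι n) : (v - w).loop = v.loop - w.loop := rfl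
theorem sub_par (v w : Vec ι n) : (v - w).par = v.par - w.par := rfl
theorem zero_loop : (0 : Vec ι n).loop = 0 := rfl
theorem zero_par : (0 : Vec ι n).par = 0 := rfl
theorem smul_loop (f : Scalar ι n) (v : Vec ι n) : (f • v).loop = f • v.loop := rfl
theorem smul_par (f : Scalar ι n) (v : Vec ι n) : (f • v).par = f • v.par := rfl

theorem sum_loop {τ : Type*} (s : Finset τ) (v : τ → Vec ι n) :
    (∑ x ∈ s, v x).loop = ∑ x ∈ s, (v x).loop :=
  map_sum (⟨⟨loop, zero_loop⟩, add_loop⟩ : Vec ι n →+ (ι → Scalar ι n)) v s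

theorem sum_par {τ : Type*} (s : Finset τ) (v : τ → Vec ι n) :
    (∑ x ∈ s, v x).par = ∑ x ∈ s, (v x).par :=
  map_sum (⟨⟨par, zero_par⟩, add_par⟩ : Vec ι n →+ (Fin (n + 1) → Scalar ι n)) v s

end Vec

section Dot

variable {ι : Type} {n : ℕ}

/-- The standard basis vector `e_μ` of `ℝ^{1,n}`. -/
abbrev basisVec (μ : Fin (n + 1)) : Vec ι n := constVec (Pi.single μ 1)

theorem metric_mul_self (μ : Fin (n + 1)) : metric μ * metric μ = 1 := by
  unfold metric; split_ifs <;> norm_num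

theorem C_metric_mul_self (μ : Fin (n + 1)) :
    (C (metric μ : ℂ) : Scalar ι n) * C (metric μ : ℂ) = 1 := by
  rw [← C_mul, ← Complex.ofReal_mul, metric_mul_self, Complex.ofReal_one, C_1]

theorem basisVec_par (μ ν : Fin (n + 1)) :
    (basisVec μ : Vec ι n).par ν = if ν = μ then 1 else 0 := by
  simp only [basisVec, constVec, Pi.single_apply]
  split_ifs <;> simp

theorem constVec_eq_sum (x : Mink n) :
    (constVec x : Vec ι n) = ∑ μ, (C (x μ : ℂ) : Scalar ι n) • basisVec μ := by
  ext1
  · simp [Vec.sum_loop, Vec.smul_loop, constVec]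
  · funext μ
    simp only [Vec.sum_par, Vec.smul_par, Finset.sum_apply, Pi.smul_apply, basisVec_par]
    simp [constVec]

variable [Fintype ι]

theorem dot_add (u v w : Vec ι n) : dot u (v + w) = dot u v + dot u w := by
  simp only [dot, Vec.add_loop, Vec.add_par, Pi.add_apply, mul_add, add_mul,
    Finset.sum_add_distrib]
  ring

theorem dot_smul (f : Scalar ι n) (u v : Vec ι n) : dot u (f • v) = f * dot u v := by
  rw [dot, dot, mul_add, mul_add]
  simp only [Vec.smul_loop, Vec.smul_par, Pi.smul_apply, smul_eq_mul, Finset.mul_sum]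
  refine congrArg₂ _ (congrArg₂ _ ?_ ?_) ?_
  · exact Finset.sum_congr rfl fun l _ => Finset.sum_congr rfl fun l' _ => by ring
  · exact Finset.sum_congr rfl fun l _ => Finset.sum_congr rfl fun μ _ => by ring
  · exact Finset.sum_congr rfl fun μ _ => by ring

theorem add_dot (u v w : Vec ι n) : dot (u + v) w = dot u w + dot v w := by
  rw [dot_comm, dot_add, dot_comm w, dot_comm w]

theorem smul_dot (f : Scalar ι n) (u v : Vec ι n) : dot (f • u) v = f * dot u v := by
  rw [dot_comm, dot_smul, dot_comm]

/-- The product of vectors as a bilinear form over the scalar functions. -/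
def dotBilin : Vec ι n →ₗ[Scalar ι n] Vec ι n →ₗ[Scalar ι n] Scalar ι n :=
  LinearMap.mk₂ _ dot add_dot smul_dot dot_add fun f u v => dot_smul f u v

theorem dot_zero (u : Vec ι n) : dot u 0 = 0 := map_zero (dotBilin u)

theorem sub_dot (u v w : Vec ι n) : dot (u - v) w = dot u w - dot v w :=
  LinearMap.map_sub₂ dotBilin u v w

theorem sum_dot {τ : Type*} (s : Finset τ) (v : τ → Vec ι n) (w : Vec ι n) :
    dot (∑ x ∈ s, v x) w = ∑ x ∈ s, dot (v x) w :=
  LinearMap.map_sum₂ dotBilin s v w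

theorem dot_sum {τ : Type*} (s : Finset τ) (u : Vec ι n) (v : τ → Vec ι n) :
    dot u (∑ x ∈ s, v x) = ∑ x ∈ s, dot u (v x) :=
  map_sum (dotBilin u) v s

theorem basisVec_dot (μ : Fin (n + 1)) (w : Vec ι n) :
    dot (basisVec μ) w
      = C (metric μ : ℂ) * ((∑ l, w.loop l * X (Sum.inr (l, μ))) + w.par μ) := by
  have loop_eq_zero : (basisVec μ : Vec ι n).loop = 0 := rfl
  simp only [dot, loop_eq_zero, basisVec_par, Pi.zero_apply]
  simp [mul_add, Finset.mul_sum, mul_assoc]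

theorem basisVec_dot_basisVec (μ ν : Fin (n + 1)) :
    dot (basisVec μ) (basisVec ν : Vec ι n) = C (if μ = ν then (metric μ : ℂ) else 0) := by
  rw [basisVec_dot, basisVec_par]
  split_ifs <;> simp [constVec]

variable [DecidableEq ι]

theorem loopVec_dot (l : ι) (w : Vec ι n) :
    dot (loopVec l) w = (∑ l', w.loop l' * X (Sum.inl s(l, l')))
      + ∑ μ, C (metric μ : ℂ) * w.par μ * X (Sum.inr (l, μ)) := by
  simp [dot, loopVec, Pi.single_apply, ite_mul]

theorem loopVec_dot_loopVec (l m : ι) :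
    dot (loopVec l) (loopVec m : Vec ι n) = X (Sum.inl s(l, m)) := by
  rw [loopVec_dot]
  simp [loopVec, Pi.single_apply, ite_mul]

theorem loopVec_dot_basisVec (l : ι) (μ : Fin (n + 1)) :
    dot (loopVec l) (basisVec μ : Vec ι n) = C (metric μ : ℂ) * X (Sum.inr (l, μ)) := by
  rw [dot_comm, basisVec_dot]
  simp [loopVec, Pi.single_apply, ite_mul]

theorem basisVec_dot_loopVec (l : ι) (μ : Fin (n + 1)) :
    dot (basisVec μ : Vec ι n) (loopVec l) = C (metric μ : ℂ) * X (Sum.inr (l, μ)) := by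
  rw [dot_comm, loopVec_dot_basisVec]

theorem Vec.eq_sum (v : Vec ι n) :
    v = (∑ l, v.loop l • loopVec l) + ∑ μ, v.par μ • basisVec μ := by
  ext1
  · funext l
    simp [add_loop, sum_loop, smul_loop, loopVec, constVec, Pi.single_apply]
  · funext μ
    simp [add_par, sum_par, smul_par, basisVec_par, loopVec]

omit [Fintype ι] in
@[elab_as_elim]
theorem Vec.induction_on [Finite ι] {p : Vec ι n → Prop} (v : Vec ι n)
    (add : ∀ v w, p v → p w → p (v + w))
    (loop : ∀ (f : Scalar ι n) l, p (f • loopVec l))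
    (par : ∀ (f : Scalar ι n) μ, p (f • basisVec μ)) : p v := by
  cases nonempty_fintype ι
  have zero : p 0 := by simpa only [zero_smul] using par 0 0
  rw [v.eq_sum]
  exact add _ _ (Finset.sum_induction _ p add zero fun l _ => loop _ l)
    (Finset.sum_induction _ p add zero fun μ _ => par _ μ)

theorem dot_eq_sum (v w : Vec ι n) :
    dot v w = (∑ l, v.loop l * dot (loopVec l) w) + ∑ μ, v.par μ * dot (basisVec μ) w := by
  conv_lhs => rw [v.eq_sum]
  simp only [add_dot, sum_dot, smul_dot]

end Dot

section Derivative

variable {ι : Type} [DecidableEq ι] {n : ℕ}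

/-- The Kronecker symbol `δ_{ab}`, as a constant scalar function. -/
def delta (a b : ι) : Scalar ι n := C (if a = b then 1 else 0)

theorem loopVec_loop (l a : ι) : (loopVec l : Vec ι n).loop a = delta a l := by
  simp only [loopVec, Pi.single_apply, delta]
  split_ifs <;> simp

theorem sum_mul_delta_left [Fintype ι] (f : ι → Scalar ι n) (p : ι) :
    ∑ a, f a * delta a p = f p := by
  simp [delta, apply_ite C]

theorem sum_mul_delta_right [Fintype ι] (f : ι → Scalar ι n) (p : ι) :
    ∑ a, f a * delta p a = f p := by
  simp [delta, apply_ite C]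

theorem grad_mul (a : ι) (f g : Scalar ι n) :
    grad a (f * g) = f • grad a g + g • grad a f := by
  ext1 <;> funext <;>
    simp only [grad, Vec.add_loop, Vec.add_par, Vec.smul_loop, Vec.smul_par, pderiv_mul,
      Pi.add_apply, Pi.smul_apply, smul_eq_mul] <;> ring

theorem grad_C (a : ι) (c : ℂ) : grad a (C c : Scalar ι n) = 0 := by
  ext1 <;> funext <;> simp [grad, Vec.zero_loop, Vec.zero_par]

theorem grad_zero (a : ι) : grad a (0 : Scalar ι n) = 0 :=
  (congrArg _ C_0.symm).trans (grad_C a 0)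

theorem grad_add (a : ι) (f g : Scalar ι n) : grad a (f + g) = grad a f + grad a g := by
  ext1 <;> funext <;> simp [grad, Vec.add_loop, Vec.add_par, mul_add]

theorem grad_X_inl (a l m : ι) : grad a (X (Sum.inl s(l, m)) : Scalar ι n)
    = (delta a l : Scalar ι n) • loopVec m + (delta a m : Scalar ι n) • loopVec l := by
  ext1
  · funext p
    simp only [grad, delta, Vec.add_loop, Vec.smul_loop, pderiv_X, Pi.add_apply, Pi.smul_apply,
      smul_eq_mul, loopVec, Pi.single_apply, Sum.inl.injEq, Sym2.eq_iff]
    by_cases h1 : l = a <;> by_cases h2 : m = p <;> by_cases h3 : m = a <;>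
      by_cases h4 : l = p <;> by_cases h5 : p = a <;> simp_all [eq_comm, one_add_one_eq_two]
  · funext μ
    simp [grad, Vec.add_par, Vec.smul_par, pderiv_X, Pi.single_apply, loopVec]

theorem grad_X_inr (a l : ι) (μ : Fin (n + 1)) : grad a (X (Sum.inr (l, μ)) : Scalar ι n)
    = (delta a l * C (metric μ : ℂ) : Scalar ι n) • basisVec μ := by
  ext1
  · funext p
    simp [grad, Vec.smul_loop, pderiv_X, Pi.single_apply, constVec]
  · funext ν
    simp only [grad, delta, Vec.smul_par, pderiv_X, Pi.smul_apply, basisVec_par, smul_eq_mul,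
      Pi.single_apply, Sum.inr.injEq, Prod.mk.injEq]
    by_cases h1 : l = a <;> by_cases h2 : μ = ν <;> simp_all [eq_comm]

variable [Fintype ι]

/-- The directional derivative `u^μ ∂/∂k_a^μ` as a derivation of the scalar functions. -/
def dirDerivation (a : ι) (u : Vec ι n) : Derivation ℂ (Scalar ι n) (Scalar ι n) :=
  Derivation.mk' {
      toFun := dirDeriv a u
      map_add' f g := by rw [dirDeriv, grad_add, dot_add, dirDeriv, dirDeriv]
      map_smul' c f := by
        rw [smul_eq_C_mul, dirDeriv, grad_mul, grad_C, smul_zero, add_zero, dot_smul,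
          RingHom.id_apply, smul_eq_C_mul, dirDeriv] }
    fun f g => by
      simp only [LinearMap.coe_mk, AddHom.coe_mk, dirDeriv, grad_mul, dot_add, dot_smul,
        smul_eq_mul]

theorem dirDerivation_apply (a : ι) (u : Vec ι n) (f : Scalar ι n) :
    dirDerivation a u f = dirDeriv a u f := rfl

theorem dirDeriv_add (a : ι) (u : Vec ι n) (f g : Scalar ι n) :
    dirDeriv a u (f + g) = dirDeriv a u f + dirDeriv a u g := map_add (dirDerivation a u) f g

theorem dirDeriv_sub (a : ι) (u : Vec ι n) (f g : Scalar ι n) :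
    dirDeriv a u (f - g) = dirDeriv a u f - dirDeriv a u g := map_sub (dirDerivation a u) f g

theorem dirDeriv_C (a : ι) (u : Vec ι n) (c : ℂ) : dirDeriv a u (C c) = 0 :=
  derivation_C (dirDerivation a u) c

theorem dirDeriv_zero (a : ι) (u : Vec ι n) : dirDeriv a u 0 = 0 := map_zero (dirDerivation a u)

theorem dirDeriv_mul (a : ι) (u : Vec ι n) (f g : Scalar ι n) :
    dirDeriv a u (f * g) = f * dirDeriv a u g + dirDeriv a u f * g := by
  rw [mul_comm (dirDeriv a u f) g]
  exact (dirDerivation a u).leibniz f g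

theorem dirDeriv_delta (a b c : ι) (u : Vec ι n) : dirDeriv a u (delta b c) = 0 :=
  dirDeriv_C a u _

theorem dirDeriv_delta_mul (a b c : ι) (u : Vec ι n) (f : Scalar ι n) :
    dirDeriv a u (delta b c * f) = delta b c * dirDeriv a u f := by
  rw [dirDeriv_mul, dirDeriv_delta, zero_mul, add_zero]

theorem dirDeriv_C_mul (a : ι) (u : Vec ι n) (c : ℂ) (f : Scalar ι n) :
    dirDeriv a u (C c * f) = C c * dirDeriv a u f := by
  rw [dirDeriv_mul, dirDeriv_C, zero_mul, add_zero]

theorem dirDeriv_X_inl (a l m : ι) (u : Vec ι n) : dirDeriv a u (X (Sum.inl s(l, m)))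
    = delta a l * dot u (loopVec m) + delta a m * dot u (loopVec l) := by
  rw [dirDeriv, grad_X_inl, dot_add, dot_smul, dot_smul]

theorem dirDeriv_X_inr (a l : ι) (μ : Fin (n + 1)) (u : Vec ι n) :
    dirDeriv a u (X (Sum.inr (l, μ))) = delta a l * C (metric μ : ℂ) * dot u (basisVec μ) := by
  rw [dirDeriv, grad_X_inr, dot_smul]

theorem add_dirDeriv (a : ι) (u v : Vec ι n) (f : Scalar ι n) :
    dirDeriv a (u + v) f = dirDeriv a u f + dirDeriv a v f := add_dot _ _ _

theorem zero_dirDeriv (a : ι) (f : Scalar ι n) : dirDeriv a (0 : Vec ι n) f = 0 :=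
  (dot_comm _ _).trans (dot_zero _)

theorem smul_dirDeriv (a : ι) (u : Vec ι n) (f g : Scalar ι n) :
    dirDeriv a (f • u) g = f * dirDeriv a u g := smul_dot _ _ _

theorem dirDeriv_eq_sum (a : ι) (u : Vec ι n) (f : Scalar ι n) :
    dirDeriv a u f = (∑ l, u.loop l * dirDeriv a (loopVec l) f)
      + ∑ μ, u.par μ * dirDeriv a (basisVec μ) f := dot_eq_sum _ _

/-- The derivative `u^μ ∂v/∂k_a^μ` of a vector `v`, where `u^μ ∂k_l/∂k_a^μ = δ_{al} u`. -/
def covDeriv (a : ι) (u v : Vec ι n) : Vec ι n :=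
  ⟨fun l => dirDeriv a u (v.loop l), fun μ => dirDeriv a u (v.par μ)⟩ + v.loop a • u

theorem covDeriv_add (a : ι) (u v w : Vec ι n) :
    covDeriv a u (v + w) = covDeriv a u v + covDeriv a u w := by
  ext1 <;> funext <;>
    simp only [covDeriv, Vec.add_loop, Vec.add_par, Vec.smul_loop, Vec.smul_par, Pi.add_apply,
      Pi.smul_apply, smul_eq_mul, dirDeriv_add] <;> ring

theorem covDeriv_smul (a : ι) (u : Vec ι n) (f : Scalar ι n) (v : Vec ι n) :
    covDeriv a u (f • v) = f • covDeriv a u v + dirDeriv a u f • v := by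
  ext1 <;> funext <;>
    simp only [covDeriv, Vec.add_loop, Vec.add_par, Vec.smul_loop, Vec.smul_par, Pi.add_apply,
      Pi.smul_apply, smul_eq_mul, dirDeriv_mul] <;> ring

theorem covDeriv_loopVec (a l : ι) (u : Vec ι n) :
    covDeriv a u (loopVec l) = (delta a l : Scalar ι n) • u := by
  have coeff_const : (⟨fun m => dirDeriv a u ((loopVec l : Vec ι n).loop m),
      fun μ => dirDeriv a u ((loopVec l : Vec ι n).par μ)⟩ : Vec ι n) = 0 := by
    ext1
    · funext m
      change dirDeriv a u ((loopVec l : Vec ι n).loop m) = 0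
      rw [loopVec_loop, dirDeriv_delta]
    · funext _
      exact dirDeriv_zero a u
  rw [covDeriv, coeff_const, loopVec_loop, zero_add]

theorem covDeriv_constVec (a : ι) (u : Vec ι n) (x : Mink n) : covDeriv a u (constVec x) = 0 := by
  have coeff_const : (⟨fun m => dirDeriv a u ((constVec x : Vec ι n).loop m),
      fun μ => dirDeriv a u ((constVec x : Vec ι n).par μ)⟩ : Vec ι n) = 0 := by
    ext1
    · funext _
      exact dirDeriv_zero a u
    · funext _
      exact dirDeriv_C a u _
  rw [covDeriv, coeff_const, zero_add]
  exact zero_smul _ u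

theorem dirDeriv_dot (a : ι) (u v w : Vec ι n) :
    dirDeriv a u (dot v w) = dot (covDeriv a u v) w + dot v (covDeriv a u w) := by
  induction v using Vec.induction_on with
  | add v v' hv hv' => simp only [add_dot, covDeriv_add, dirDeriv_add, hv, hv']; ring
  | loop f l =>
    induction w using Vec.induction_on with
    | add w w' hw hw' => simp only [dot_add, covDeriv_add, dirDeriv_add, hw, hw']; ring
    | loop g m =>
      simp only [covDeriv_smul, covDeriv_loopVec, add_dot, dot_add, smul_dot, dot_smul,
        dirDeriv_mul, loopVec_dot_loopVec, dirDeriv_X_inl, dot_comm u]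
      ring
    | par g μ =>
      simp only [covDeriv_smul, covDeriv_loopVec, covDeriv_constVec, add_dot, dot_add, smul_dot,
        dot_smul, dot_zero, dirDeriv_mul, dirDeriv_C, loopVec_dot_basisVec, dirDeriv_X_inr]
      linear_combination f * g * delta a l * dot u (basisVec μ) * C_metric_mul_self μ
  | par f μ =>
    induction w using Vec.induction_on with
    | add w w' hw hw' => simp only [dot_add, covDeriv_add, dirDeriv_add, hw, hw']; ring
    | loop g m =>
      simp only [covDeriv_smul, covDeriv_loopVec, covDeriv_constVec, add_dot, dot_add, smul_dot,
        dot_smul, dot_comm 0, dot_zero, dirDeriv_mul, dirDeriv_C, basisVec_dot_loopVec,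
        dirDeriv_X_inr, dot_comm _ u]
      linear_combination f * g * delta a m * dot u (basisVec μ) * C_metric_mul_self μ
    | par g ν =>
      simp only [covDeriv_smul, covDeriv_constVec, add_dot, dot_add, smul_dot, dot_smul,
        dot_comm 0, dot_zero, dirDeriv_mul, dirDeriv_C, basisVec_dot_basisVec]
      ring

/-- The flat connection is torsion-free: `∇_u v - ∇_v u = [u, v]`. -/
theorem dirDeriv_comm (a b : ι) (u v : Vec ι n) (f : Scalar ι n) :
    dirDeriv a u (dirDeriv b v f) + dirDeriv a (covDeriv b v u) f
      = dirDeriv b v (dirDeriv a u f) + dirDeriv b (covDeriv a u v) f := by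
  suffices ⁅dirDerivation a u, dirDerivation b v⁆
      = dirDerivation b (covDeriv a u v) - dirDerivation a (covDeriv b v u) by
    have h := DFunLike.congr_fun this f
    rw [Derivation.commutator_apply, Derivation.sub_apply] at h
    simp only [dirDerivation_apply] at h
    linear_combination h
  refine derivation_ext fun x => ?_
  rw [Derivation.commutator_apply, Derivation.sub_apply]
  simp only [dirDerivation_apply]
  rcases x with z | ⟨l, μ⟩
  · induction z with
    | _ l m =>
      simp only [dirDeriv_X_inl, dirDeriv_add, dirDeriv_delta_mul, dirDeriv_dot, covDeriv_loopVec,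
        dot_smul, dot_comm v u]
      ring
  · simp only [dirDeriv_X_inr, mul_assoc, dirDeriv_delta_mul, dirDeriv_C_mul, dirDeriv_dot,
      covDeriv_constVec, dot_zero]
    ring

end Derivative

section Laplacian

variable {ι : Type} {n : ℕ}

@[elab_as_elim]
theorem scalar_induction {p : Scalar ι n → Prop} (f : Scalar ι n) (const : ∀ c, p (C c))
    (add : ∀ f g, p f → p g → p (f + g))
    (X_inl_mul : ∀ l m f, p f → p (X (Sum.inl s(l, m)) * f))
    (X_inr_mul : ∀ l μ f, p f → p (X (Sum.inr (l, μ)) * f)) : p f := by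
  induction f using MvPolynomial.induction_on with
  | C c => exact const c
  | add f g hf hg => exact add f g hf hg
  | mul_X f x hf =>
    rw [mul_comm]
    rcases x with z | ⟨l, μ⟩
    · induction z with
      | _ l m => exact X_inl_mul l m f hf
    · exact X_inr_mul l μ f hf

variable [Fintype ι] [DecidableEq ι] (D : ℂ) (a b c : ι)

theorem divergence_add (u v : Vec ι n) :
    divergence D a (u + v) = divergence D a u + divergence D a v := by
  simp only [divergence, Vec.add_loop, Vec.add_par, Pi.add_apply, dirDeriv_add,
    Finset.sum_add_distrib]
  ring

theorem divergence_smul (f : Scalar ι n) (u : Vec ι n) :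
    divergence D a (f • u) = f * divergence D a u + dirDeriv a u f := by
  simp only [divergence, Vec.smul_loop, Vec.smul_par, Pi.smul_apply, smul_eq_mul, dirDeriv_mul,
    Finset.sum_add_distrib, ← Finset.mul_sum, dirDeriv_eq_sum a u f, mul_comm (u.loop _),
    mul_comm (u.par _)]
  ring

theorem divergence_C_smul (r : ℂ) (u : Vec ι n) :
    divergence D a ((C r : Scalar ι n) • u) = C r * divergence D a u := by
  rw [divergence_smul, dirDeriv_C, add_zero]

theorem divergence_sum {τ : Type*} (s : Finset τ) (u : τ → Vec ι n) :
    divergence D a (∑ x ∈ s, u x) = ∑ x ∈ s, divergence D a (u x) :=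
  map_sum (AddMonoidHom.mk' (divergence D a) (divergence_add D a)) u s

theorem divergence_loopVec (l : ι) :
    divergence D a (loopVec l : Vec ι n) = C D * delta a l := by
  have par_eq_zero : (loopVec l : Vec ι n).par = 0 := rfl
  simp only [divergence, loopVec_loop, par_eq_zero, Pi.zero_apply, dirDeriv_zero, delta, dirDeriv_C,
    Finset.sum_const_zero, add_zero]

theorem divergence_constVec (x : Mink n) : divergence D a (constVec x : Vec ι n) = 0 := by
  simp [divergence, constVec, dirDeriv_zero, dirDeriv_C]

/-- The second-order operator `∂_a · ∂_b`. -/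
def laplace (f : Scalar ι n) : Scalar ι n := divergence D a (grad b f)

theorem laplace_add (f g : Scalar ι n) :
    laplace D a b (f + g) = laplace D a b f + laplace D a b g := by
  rw [laplace, grad_add, divergence_add, laplace, laplace]

theorem laplace_sum {τ : Type*} (s : Finset τ) (f : τ → Scalar ι n) :
    laplace D a b (∑ x ∈ s, f x) = ∑ x ∈ s, laplace D a b (f x) :=
  map_sum (AddMonoidHom.mk' (laplace D a b) (laplace_add D a b)) f s

theorem laplace_C (r : ℂ) : laplace D a b (C r : Scalar ι n) = 0 := by
  rw [laplace, grad_C, ← zero_smul (Scalar ι n) 0, divergence_smul, zero_mul, dirDeriv_zero,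
    add_zero]

theorem laplace_zero : laplace D a b (0 : Scalar ι n) = 0 :=
  (congrArg _ C_0.symm).trans (laplace_C D a b 0)

theorem laplace_mul (f g : Scalar ι n) :
    laplace D a b (f * g) = f * laplace D a b g + g * laplace D a b f
      + dirDeriv b (grad a f) g + dirDeriv a (grad b f) g := by
  have symm : dirDeriv a (grad b g) f = dirDeriv b (grad a f) g := dot_comm _ _
  rw [laplace, grad_mul, divergence_add, divergence_smul, divergence_smul, symm, laplace, laplace]
  ring

theorem laplace_C_mul (r : ℂ) (f : Scalar ι n) :
    laplace D a b (C r * f) = C r * laplace D a b f := by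
  rw [laplace, grad_mul, grad_C, smul_zero, add_zero, divergence_C_smul, laplace]

theorem laplace_delta_mul (p q : ι) (f : Scalar ι n) :
    laplace D a b (delta p q * f) = delta p q * laplace D a b f := laplace_C_mul D a b _ f

theorem laplace_X_inr_mul (l : ι) (μ : Fin (n + 1)) (f : Scalar ι n) :
    laplace D a b (X (Sum.inr (l, μ)) * f) = X (Sum.inr (l, μ)) * laplace D a b f
      + C (metric μ : ℂ) * (delta a l * dirDeriv b (basisVec μ) f
        + delta b l * dirDeriv a (basisVec μ) f) := by
  rw [laplace_mul]
  simp only [laplace, grad_X_inr, divergence_smul, divergence_constVec, delta, ← C_mul,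
    dirDeriv_C, smul_dirDeriv]
  simp only [C_mul]
  ring

theorem laplace_X_inl_mul (l m : ι) (f : Scalar ι n) :
    laplace D a b (X (Sum.inl s(l, m)) * f) = X (Sum.inl s(l, m)) * laplace D a b f
      + C D * (delta a l * delta b m + delta a m * delta b l) * f
      + delta a l * dirDeriv b (loopVec m) f + delta a m * dirDeriv b (loopVec l) f
      + delta b l * dirDeriv a (loopVec m) f + delta b m * dirDeriv a (loopVec l) f := by
  rw [laplace_mul]
  simp only [laplace, grad_X_inl, divergence_add, divergence_smul, divergence_loopVec,
    smul_dirDeriv, add_dirDeriv]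
  simp only [delta, dirDeriv_C]
  ring

theorem laplace_dirDeriv_basisVec (μ : Fin (n + 1)) (f : Scalar ι n) :
    laplace D a b (dirDeriv c (basisVec μ) f) = dirDeriv c (basisVec μ) (laplace D a b f) := by
  have comm_basisVec (p : ι) (ν : Fin (n + 1)) (g : Scalar ι n) :
      dirDeriv c (basisVec μ) (dirDeriv p (basisVec ν) g)
        = dirDeriv p (basisVec ν) (dirDeriv c (basisVec μ) g) := by
    simpa only [covDeriv_constVec, zero_dirDeriv, add_zero] using
      dirDeriv_comm c p (basisVec μ) (basisVec ν) g
  have comm_loopVec (p l : ι) (g : Scalar ι n) :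
      dirDeriv c (basisVec μ) (dirDeriv p (loopVec l) g)
        = dirDeriv p (loopVec l) (dirDeriv c (basisVec μ) g)
          + delta c l * dirDeriv p (basisVec μ) g := by
    simpa only [covDeriv_constVec, covDeriv_loopVec, zero_dirDeriv, smul_dirDeriv, add_zero] using
      dirDeriv_comm c p (basisVec μ) (loopVec l) g
  induction f using scalar_induction with
  | const r => simp only [dirDeriv_C, laplace_C, laplace_zero, dirDeriv_zero]
  | add f g hf hg => simp only [dirDeriv_add, laplace_add, hf, hg]
  | X_inl_mul l m f hf =>
    simp only [dirDeriv_mul, dirDeriv_add, dirDeriv_C, dirDeriv_delta, laplace_X_inl_mul,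
      dirDeriv_X_inl, basisVec_dot_loopVec, laplace_X_inr_mul, laplace_add, laplace_C_mul,
      laplace_delta_mul, comm_loopVec, hf, mul_assoc, add_mul]
    linear_combination (delta c m * (delta a l * dirDeriv b (basisVec μ) f
      + delta b l * dirDeriv a (basisVec μ) f) + delta c l * (delta a m * dirDeriv b (basisVec μ) f
      + delta b m * dirDeriv a (basisVec μ) f)) * C_metric_mul_self μ
  | X_inr_mul l ν f hf =>
    simp only [dirDeriv_mul, dirDeriv_add, dirDeriv_C, dirDeriv_delta, laplace_X_inr_mul,
      dirDeriv_X_inr, basisVec_dot_basisVec, laplace_add, laplace_C_mul, laplace_delta_mul,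
      comm_basisVec, hf, mul_assoc]
    ring

theorem laplace_dirDeriv_loopVec (m : ι) (f : Scalar ι n) :
    laplace D a b (dirDeriv c (loopVec m) f) = dirDeriv c (loopVec m) (laplace D a b f)
      + delta a m * laplace D c b f + delta b m * laplace D c a f := by
  have comm_basisVec (p : ι) (ν : Fin (n + 1)) (g : Scalar ι n) :
      dirDeriv c (loopVec m) (dirDeriv p (basisVec ν) g) + delta p m * dirDeriv c (basisVec ν) g
        = dirDeriv p (basisVec ν) (dirDeriv c (loopVec m) g) := by
    simpa only [covDeriv_constVec, covDeriv_loopVec, zero_dirDeriv, smul_dirDeriv, add_zero] using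
      dirDeriv_comm c p (loopVec m) (basisVec ν) g
  have comm_loopVec (p l : ι) (g : Scalar ι n) :
      dirDeriv c (loopVec m) (dirDeriv p (loopVec l) g) + delta p m * dirDeriv c (loopVec l) g
        = dirDeriv p (loopVec l) (dirDeriv c (loopVec m) g)
          + delta c l * dirDeriv p (loopVec m) g := by
    simpa only [covDeriv_loopVec, smul_dirDeriv] using
      dirDeriv_comm c p (loopVec m) (loopVec l) g
  induction f using scalar_induction with
  | const r => simp only [dirDeriv_C, laplace_C, laplace_zero, dirDeriv_zero, mul_zero, add_zero]
  | add f g hf hg => simp only [dirDeriv_add, laplace_add, hf, hg]; ring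
  | X_inl_mul p q f hf =>
    simp only [dirDeriv_mul, dirDeriv_add, dirDeriv_C, dirDeriv_delta, dirDeriv_X_inl,
      loopVec_dot_loopVec, laplace_X_inl_mul, laplace_add, laplace_delta_mul, hf, mul_assoc,
      add_mul]
    linear_combination - delta a p * comm_loopVec b q f - delta a q * comm_loopVec b p f
      - delta b p * comm_loopVec a q f - delta b q * comm_loopVec a p f
  | X_inr_mul p ν f hf =>
    simp only [dirDeriv_mul, dirDeriv_add, dirDeriv_C, dirDeriv_delta, dirDeriv_X_inr,
      loopVec_dot_basisVec, laplace_X_inr_mul, laplace_add, laplace_delta_mul, laplace_C_mul, hf,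
      mul_assoc]
    linear_combination delta c p * C (metric ν : ℂ) * (delta a m * dirDeriv b (basisVec ν) f
        + delta b m * dirDeriv a (basisVec ν) f) * C_metric_mul_self ν
      - C (metric ν : ℂ) * (delta a p * comm_basisVec b ν f + delta b p * comm_basisVec a ν f)

/-- The operator `∂_a · ∂_b` applied to a vector. -/
def vecLaplace (u : Vec ι n) : Vec ι n :=
  ⟨fun l => laplace D a b (u.loop l), fun μ => laplace D a b (u.par μ)⟩
    + grad a (u.loop b) + grad b (u.loop a)

theorem vecLaplace_add (u v : Vec ι n) :
    vecLaplace D a b (u + v) = vecLaplace D a b u + vecLaplace D a b v := by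
  simp only [vecLaplace, Vec.add_loop, Vec.add_par, Pi.add_apply, grad_add, laplace_add]
  ext1 <;> funext <;> simp only [Vec.add_loop, Vec.add_par, Pi.add_apply] <;> ring

theorem vecLaplace_smul_loopVec (f : Scalar ι n) (l : ι) :
    vecLaplace D a b (f • loopVec l) = laplace D a b f • loopVec l
      + (delta b l : Scalar ι n) • grad a f + (delta a l : Scalar ι n) • grad b f := by
  have coeff : (⟨fun m => laplace D a b ((f • loopVec l : Vec ι n).loop m),
      fun μ => laplace D a b ((f • loopVec l : Vec ι n).par μ)⟩ : Vec ι n)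
      = laplace D a b f • loopVec l := by
    ext1 <;> funext
    · simp only [Vec.smul_loop, Pi.smul_apply, smul_eq_mul, loopVec_loop, mul_comm _ (delta _ _),
        laplace_delta_mul]
    · simp [Vec.smul_par, loopVec, laplace_zero]
  have grad_coeff (p q : ι) : grad p ((f • loopVec l : Vec ι n).loop q)
      = (delta q l : Scalar ι n) • grad p f := by
    rw [Vec.smul_loop, Pi.smul_apply, loopVec_loop, smul_eq_mul, grad_mul, delta, grad_C,
      smul_zero, zero_add]
  rw [vecLaplace, coeff, grad_coeff, grad_coeff]

theorem vecLaplace_smul_basisVec (f : Scalar ι n) (μ : Fin (n + 1)) :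
    vecLaplace D a b (f • basisVec μ) = laplace D a b f • basisVec μ := by
  have coeff : (⟨fun m => laplace D a b ((f • basisVec μ : Vec ι n).loop m),
      fun ν => laplace D a b ((f • basisVec μ : Vec ι n).par ν)⟩ : Vec ι n)
      = laplace D a b f • basisVec μ := by
    ext1 <;> funext
    · simp [Vec.smul_loop, constVec, laplace_zero]
    · simp only [Vec.smul_par, Pi.smul_apply, smul_eq_mul, basisVec_par]
      split_ifs <;> simp [laplace_zero]
  have grad_coeff (p q : ι) : grad p ((f • basisVec μ : Vec ι n).loop q) = 0 := by
    simp [Vec.smul_loop, constVec, grad_zero]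
  rw [vecLaplace, coeff, grad_coeff, grad_coeff, add_zero, add_zero]

theorem laplace_basisVec_dot (μ : Fin (n + 1)) (u : Vec ι n) :
    laplace D a b (dot (basisVec μ) u) = dot (basisVec μ) (vecLaplace D a b u) := by
  induction u using Vec.induction_on with
  | add u v hu hv => simp only [dot_add, laplace_add, vecLaplace_add, hu, hv]
  | loop f m =>
    simp only [vecLaplace_smul_loopVec, dot_add, dot_smul, basisVec_dot_loopVec,
      mul_left_comm f, mul_comm f, laplace_C_mul, laplace_X_inr_mul, dirDeriv]
    linear_combination (delta a m * dot (basisVec μ) (grad b f)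
      + delta b m * dot (basisVec μ) (grad a f)) * C_metric_mul_self μ
  | par f ν =>
    simp only [vecLaplace_smul_basisVec, dot_smul, basisVec_dot_basisVec, mul_comm _ (C _),
      laplace_C_mul]

theorem laplace_constVec_dot (x : Mink n) (u : Vec ι n) :
    laplace D a b (dot (constVec x) u) = dot (constVec x) (vecLaplace D a b u) := by
  simp only [constVec_eq_sum x, sum_dot, smul_dot, laplace_sum, laplace_C_mul,
    laplace_basisVec_dot]

theorem laplace_loopVec_dot (l : ι) (u : Vec ι n) :
    laplace D a b (dot (loopVec l) u) = dot (loopVec l) (vecLaplace D a b u)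
      + delta a l * divergence D b u + delta b l * divergence D a u := by
  induction u using Vec.induction_on with
  | add u v hu hv => simp only [dot_add, laplace_add, vecLaplace_add, divergence_add, hu, hv]; ring
  | loop f m =>
    simp only [vecLaplace_smul_loopVec, dot_add, dot_smul, loopVec_dot_loopVec, divergence_smul,
      divergence_loopVec, mul_comm f, laplace_X_inl_mul, dirDeriv]
    ring
  | par f μ =>
    simp only [vecLaplace_smul_basisVec, dot_smul, loopVec_dot_basisVec, divergence_smul,
      divergence_constVec, mul_comm f, mul_assoc, laplace_C_mul, laplace_X_inr_mul]
    linear_combination (delta a l * dirDeriv b (basisVec μ) f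
      + delta b l * dirDeriv a (basisVec μ) f) * C_metric_mul_self μ

theorem laplace_divergence (u : Vec ι n) :
    laplace D a b (divergence D c u) = divergence D c (vecLaplace D a b u) := by
  induction u using Vec.induction_on with
  | add u v hu hv => simp only [vecLaplace_add, divergence_add, laplace_add, hu, hv]
  | loop f m =>
    simp only [vecLaplace_smul_loopVec, divergence_add, divergence_smul, divergence_loopVec,
      laplace_add, laplace_dirDeriv_loopVec, mul_comm f, mul_assoc, laplace_C_mul,
      laplace_delta_mul, dirDeriv_delta]
    simp only [laplace]
    ring
  | par f μ =>
    simp only [vecLaplace_smul_basisVec, divergence_smul, divergence_constVec, mul_zero, zero_add,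
      laplace_dirDeriv_basisVec]

end Laplacian

section Contraction

variable {ι : Type} [Fintype ι] [DecidableEq ι] {n : ℕ} (D : ℂ) (B : Matrix ι ι ℝ)

theorem contraction_eq_sum (f : Scalar ι n) :
    contraction D B f = ∑ a, ∑ b, C (B a b : ℂ) * laplace D a b f := rfl

/-- The contraction `∑_{a,b} B_{ab} ∂_a · ∂_b` applied to a scalar function, as a linear map. -/
def contractionₗ : Scalar ι n →ₗ[ℂ] Scalar ι n where
  toFun := contraction D B
  map_add' f g := by
    simp only [contraction_eq_sum, laplace_add, mul_add, Finset.sum_add_distrib]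
  map_smul' r f := by
    simp only [contraction_eq_sum, smul_eq_C_mul, laplace_C_mul, Finset.mul_sum, mul_left_comm,
      RingHom.id_apply]

/-- The contraction `∑_{a,b} B_{ab} ∂_a · ∂_b` applied to a vector. -/
def vecContraction (u : Vec ι n) : Vec ι n :=
  ∑ a, ∑ b, (C (B a b : ℂ) : Scalar ι n) • vecLaplace D a b u

theorem contraction_constVec_dot (x : Mink n) (u : Vec ι n) :
    contraction D B (dot (constVec x) u) = dot (constVec x) (vecContraction D B u) := by
  simp only [contraction_eq_sum, vecContraction, laplace_constVec_dot, dot_sum, dot_smul]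

theorem contraction_divergence (c : ι) (u : Vec ι n) :
    contraction D B (divergence D c u) = divergence D c (vecContraction D B u) := by
  simp only [contraction_eq_sum, vecContraction, laplace_divergence, divergence_sum,
    divergence_C_smul]

theorem iterate_contraction_constVec_dot (m : ℕ) (x : Mink n) (u : Vec ι n) :
    (contraction D B)^[m] (dot (constVec x) u)
      = dot (constVec x) ((vecContraction D B)^[m] u) :=
  (Function.Semiconj.iterate_right (fun u => (contraction_constVec_dot D B x u).symm) m u).symm

theorem iterate_contraction_divergence (m : ℕ) (c : ι) (u : Vec ι n) :
    (contraction D B)^[m] (divergence D c u)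
      = divergence D c ((vecContraction D B)^[m] u) :=
  (Function.Semiconj.iterate_right (fun u => (contraction_divergence D B c u).symm) m u).symm

variable {B}

theorem contraction_loopVec_dot (hB : B.IsSymm) (l : ι) (u : Vec ι n) :
    contraction D B (dot (loopVec l) u) = dot (loopVec l) (vecContraction D B u)
      + 2 * ∑ b, C (B l b : ℂ) * divergence D b u := by
  have first : ∑ a, ∑ b, C (B a b : ℂ) * (delta a l * divergence D b u)
      = ∑ b, C (B l b : ℂ) * divergence D b u := by
    rw [Finset.sum_comm]
    refine Finset.sum_congr rfl fun b _ => ?_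
    rw [← sum_mul_delta_left (fun a => C (B a b : ℂ) * divergence D b u) l]
    exact Finset.sum_congr rfl fun a _ => by ring
  have second : ∑ a, ∑ b, C (B a b : ℂ) * (delta b l * divergence D a u)
      = ∑ b, C (B l b : ℂ) * divergence D b u := by
    refine Finset.sum_congr rfl fun a _ => ?_
    rw [← hB.apply l a, ← sum_mul_delta_left (fun b => C (B a b : ℂ) * divergence D a u) l]
    exact Finset.sum_congr rfl fun b _ => by ring
  simp only [contraction_eq_sum, vecContraction, laplace_loopVec_dot, dot_sum, dot_smul, mul_add,
    Finset.sum_add_distrib, first, second]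
  ring

theorem iterate_contraction_loopVec_dot (hB : B.IsSymm) (m : ℕ) (l : ι) (u : Vec ι n) :
    (contraction D B)^[m + 1] (dot (loopVec l) u)
      = dot (loopVec l) ((vecContraction D B)^[m + 1] u)
        + ∑ b, (2 * (m + 1) * B l b : ℂ) • (contraction D B)^[m] (divergence D b u) := by
  induction m with
  | zero =>
    simp [contraction_loopVec_dot D hB, Finset.mul_sum, smul_eq_C_mul, mul_assoc,
      show (C 2 : Scalar ι n) = 2 from map_ofNat C 2]
  | succ m ih =>
    have map_sum_smul : contraction D B
          (∑ b, (2 * (m + 1) * B l b : ℂ) • (contraction D B)^[m] (divergence D b u))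
        = ∑ b, (2 * (m + 1) * B l b : ℂ) • (contraction D B)^[m + 1] (divergence D b u) := by
      refine (map_sum (contractionₗ D B) _ _).trans (Finset.sum_congr rfl fun b _ => ?_)
      rw [map_smul, Function.iterate_succ_apply']
      rfl
    rw [Function.iterate_succ_apply', ih,
      show ∀ f g : Scalar ι n, contraction D B (f + g) = contraction D B f + contraction D B g from
        map_add (contractionₗ D B), map_sum_smul, contraction_loopVec_dot D hB,
      ← Function.iterate_succ_apply' (vecContraction D B), add_assoc, Finset.mul_sum,
      ← Finset.sum_add_distrib]
    congr 1
    refine Finset.sum_congr rfl fun b _ => ?_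
    rw [← iterate_contraction_divergence]
    simp only [smul_eq_C_mul]
    push_cast
    simp only [C_mul, C_add, map_ofNat, C_1]
    ring

end Contraction

section Degree

theorem totalDegree_pderiv_le {R σ : Type*} [CommSemiring R] (x : σ) (f : MvPolynomial σ R) :
    (pderiv x f).totalDegree ≤ f.totalDegree - 1 := by
  refine Finset.sup_le fun m hm => ?_
  rw [mem_support_iff, coeff_pderiv] at hm
  have h := le_totalDegree (mem_support_iff.mpr (left_ne_zero_of_mul hm))
  rw [Finsupp.sum_add_index' (fun _ => rfl) (fun _ _ _ => rfl), Finsupp.sum_single_index rfl] at h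
  omega

variable {R σ : Type*} [CommSemiring R] {f g : MvPolynomial σ R} {d e : ℕ}

theorem totalDegree_mul_le_of_le (hf : f.totalDegree ≤ d) (hg : g.totalDegree ≤ e) :
    (f * g).totalDegree ≤ d + e :=
  (totalDegree_mul f g).trans (add_le_add hf hg)

theorem totalDegree_add_le_of_le (hf : f.totalDegree ≤ d) (hg : g.totalDegree ≤ d) :
    (f + g).totalDegree ≤ d :=
  (totalDegree_add f g).trans (max_le hf hg)

theorem totalDegree_C_mul_le_of_le (r : R) (hf : f.totalDegree ≤ d) :
    (C r * f).totalDegree ≤ d := by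
  simpa only [zero_add] using totalDegree_mul_le_of_le (totalDegree_C r).le hf

end Degree

section ContractionDegree

variable {ι : Type} [DecidableEq ι] {n : ℕ}

theorem totalDegree_grad_loop_le (a : ι) (f : Scalar ι n) (l : ι) :
    ((grad a f).loop l).totalDegree ≤ f.totalDegree - 1 := by
  have grad_eq : (grad a f).loop l
      = C (if l = a then 2 else 1) * pderiv (Sum.inl s(a, l)) f := by
    simp only [grad]
    split_ifs
    · rw [map_ofNat]
    · rw [C_1]
  rw [grad_eq]
  exact totalDegree_C_mul_le_of_le _ (totalDegree_pderiv_le _ _)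

theorem totalDegree_grad_par_le (a : ι) (f : Scalar ι n) (μ : Fin (n + 1)) :
    ((grad a f).par μ).totalDegree ≤ f.totalDegree - 1 :=
  totalDegree_C_mul_le_of_le _ (totalDegree_pderiv_le _ _)

variable [Fintype ι] (D : ℂ) (B : Matrix ι ι ℝ)

theorem totalDegree_loopVec_dot_le {d : ℕ} (l : ι) {u : Vec ι n}
    (loop_le : ∀ m, (u.loop m).totalDegree ≤ d) (par_le : ∀ μ, (u.par μ).totalDegree ≤ d) :
    (dot (loopVec l) u).totalDegree ≤ d + 1 := by
  rw [loopVec_dot]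
  exact totalDegree_add_le_of_le
    (totalDegree_finsetSum_le fun m _ =>
      totalDegree_mul_le_of_le (loop_le m) (totalDegree_X _).le)
    (totalDegree_finsetSum_le fun μ _ =>
      totalDegree_mul_le_of_le (totalDegree_C_mul_le_of_le _ (par_le μ)) (totalDegree_X _).le)

omit [DecidableEq ι] in
theorem totalDegree_basisVec_dot_le {d : ℕ} (μ : Fin (n + 1)) {u : Vec ι n}
    (loop_le : ∀ m, (u.loop m).totalDegree ≤ d) (par_le : ∀ ν, (u.par ν).totalDegree ≤ d) :
    (dot (basisVec μ) u).totalDegree ≤ d + 1 := by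
  rw [basisVec_dot]
  exact totalDegree_C_mul_le_of_le _ (totalDegree_add_le_of_le
    (totalDegree_finsetSum_le fun m _ =>
      totalDegree_mul_le_of_le (loop_le m) (totalDegree_X _).le)
    ((par_le μ).trans d.le_succ))

theorem totalDegree_divergence_le (a : ι) {u : Vec ι n} {d : ℕ}
    (loop_le : ∀ l, (u.loop l).totalDegree ≤ d) (par_le : ∀ μ, (u.par μ).totalDegree ≤ d) :
    (divergence D a u).totalDegree ≤ d := by
  have dirDeriv_le {w : Vec ι n} {f : Scalar ι n} (hf : f.totalDegree ≤ d)
      (hw : (dirDeriv a w f).totalDegree ≤ f.totalDegree - 1 + 1) :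
      (dirDeriv a w f).totalDegree ≤ d := by
    rcases Nat.eq_zero_or_pos f.totalDegree with h | h
    · rw [totalDegree_eq_zero_iff_eq_C.mp h, dirDeriv_C, totalDegree_zero]
      exact d.zero_le
    · omega
  refine totalDegree_add_le_of_le (totalDegree_add_le_of_le
    (totalDegree_C_mul_le_of_le _ (loop_le a)) (totalDegree_finsetSum_le fun l _ => ?_))
    (totalDegree_finsetSum_le fun μ _ => ?_)
  · exact dirDeriv_le (loop_le l) (totalDegree_loopVec_dot_le l (totalDegree_grad_loop_le a _)
      (totalDegree_grad_par_le a _))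
  · exact dirDeriv_le (par_le μ) (totalDegree_basisVec_dot_le μ (totalDegree_grad_loop_le a _)
      (totalDegree_grad_par_le a _))

theorem totalDegree_contraction_le (f : Scalar ι n) :
    (contraction D B f).totalDegree ≤ f.totalDegree - 1 :=
  totalDegree_finsetSum_le fun a _ => totalDegree_finsetSum_le fun b _ =>
    totalDegree_C_mul_le_of_le _ (totalDegree_divergence_le D a (totalDegree_grad_loop_le b f)
      (totalDegree_grad_par_le b f))

theorem contraction_C (r : ℂ) : contraction D B (C r : Scalar ι n) = 0 := by
  simp only [contraction_eq_sum, laplace_C, mul_zero, Finset.sum_const_zero]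

theorem iterate_contraction_eq_zero {f : Scalar ι n} {m : ℕ} (hm : f.totalDegree < m) :
    (contraction D B)^[m] f = 0 := by
  induction m generalizing f with
  | zero => omega
  | succ m ih =>
    rw [Function.iterate_succ_apply]
    rcases Nat.eq_zero_or_pos f.totalDegree with h | h
    · rw [totalDegree_eq_zero_iff_eq_C.mp h, contraction_C]
      exact Function.iterate_fixed (map_zero (contractionₗ D B)) m
    · exact ih ((totalDegree_contraction_le D B f).trans_lt (by omega))

end ContractionDegree

section WickMean

variable {ι : Type} [Fintype ι] [DecidableEq ι] {n : ℕ} (D : ℂ) (B : Matrix ι ι ℝ)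
  (κ : ι → Mink n)

/-- Evaluation at `k_l = κ_l` as a linear functional. -/
def evalAtₗ : Scalar ι n →ₗ[ℂ] ℂ where
  toFun := evalAt κ
  map_add' _ _ := map_add (eval _) _ _
  map_smul' r f := smul_eval _ f r

/-- A partial sum of Wick's exponential series, as a linear functional. -/
def wickSum (K : ℕ) : Scalar ι n →ₗ[ℂ] ℂ :=
  ∑ m ∈ Finset.range K,
    ((Complex.I / 4) ^ m / (m.factorial : ℂ)) • (evalAtₗ κ ∘ₗ contractionₗ D B ^ m)

theorem wickSum_apply (K : ℕ) (f : Scalar ι n) :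
    wickSum D B κ K f = ∑ m ∈ Finset.range K,
      (Complex.I / 4) ^ m / (m.factorial : ℂ) * evalAt κ ((contraction D B)^[m] f) := by
  simp only [wickSum, LinearMap.sum_apply, LinearMap.smul_apply, LinearMap.comp_apply,
    Module.End.pow_apply, smul_eq_mul]
  rfl

theorem wickMean_eq_wickSum {K : ℕ} {f : Scalar ι n} (hK : f.totalDegree < K) :
    wickMean D B κ f = wickSum D B κ K f := by
  rw [wickSum_apply, wickMean]
  refine Finset.sum_subset (Finset.range_mono hK) fun m _ hm => ?_
  rw [Finset.mem_range, not_lt] at hm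
  rw [iterate_contraction_eq_zero D B hm, evalAt, map_zero, mul_zero]

/-- The Gaussian mean as a linear functional. -/
def wickMeanₗ : Scalar ι n →ₗ[ℂ] ℂ where
  toFun := wickMean D B κ
  map_add' f g := by
    set K := max (max f.totalDegree g.totalDegree) (f + g).totalDegree + 1
    rw [wickMean_eq_wickSum D B κ (K := K) (f := f) (by omega),
      wickMean_eq_wickSum D B κ (K := K) (f := g) (by omega),
      wickMean_eq_wickSum D B κ (K := K) (f := f + g) (by omega), map_add]
  map_smul' r f := by
    set K := max f.totalDegree (r • f).totalDegree + 1
    rw [wickMean_eq_wickSum D B κ (K := K) (f := f) (by omega),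
      wickMean_eq_wickSum D B κ (K := K) (f := r • f) (by omega), map_smul, RingHom.id_apply]

theorem wickMean_add (f g : Scalar ι n) :
    wickMean D B κ (f + g) = wickMean D B κ f + wickMean D B κ g := map_add (wickMeanₗ D B κ) f g

theorem wickMean_C_mul (r : ℂ) (f : Scalar ι n) :
    wickMean D B κ (C r * f) = r * wickMean D B κ f := by
  rw [← smul_eq_C_mul]
  exact map_smul (wickMeanₗ D B κ) r f

theorem wickMean_sum {τ : Type*} (s : Finset τ) (f : τ → Scalar ι n) :
    wickMean D B κ (∑ x ∈ s, f x) = ∑ x ∈ s, wickMean D B κ (f x) :=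
  map_sum (wickMeanₗ D B κ) f s

theorem evalAt_loopVec_dot (l : ι) (u : Vec ι n) :
    evalAt κ (dot (loopVec l) u) = evalAt κ (dot (constVec (κ l)) u) := by
  induction u using Vec.induction_on with
  | add u v hu hv =>
    simp only [dot_add]
    exact (map_add (eval _) _ _).trans ((congrArg₂ _ hu hv).trans (map_add (eval _) _ _).symm)
  | loop f m =>
    simp only [evalAt, dot_smul, map_mul, loopVec_dot_loopVec, constVec_eq_sum (κ l), sum_dot,
      smul_dot, basisVec_dot_loopVec, map_sum, eval_X, eval_C, Sum.elim_inl, Sum.elim_inr,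
      Sym2.lift_mk, mdot, Complex.ofReal_sum, Complex.ofReal_mul]
    congr 1
    exact Finset.sum_congr rfl fun μ _ => by ring
  | par f μ =>
    simp only [evalAt, dot_smul, map_mul, loopVec_dot_basisVec, constVec_eq_sum (κ l), sum_dot,
      smul_dot, basisVec_dot_basisVec, map_sum, eval_X, eval_C, Sum.elim_inr]
    simp [mul_comm]

variable {B}

theorem evalAt_iterate_contraction_sub_dot (hB : B.IsSymm) (m : ℕ) (l : ι) (u : Vec ι n) :
    evalAt κ ((contraction D B)^[m + 1] (dot (loopVec l - constVec (κ l)) u))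
      = 2 * (m + 1) * ∑ b, (B l b : ℂ) * evalAt κ ((contraction D B)^[m] (divergence D b u)) := by
  have iterate_sub (f g : Scalar ι n) : (contraction D B)^[m + 1] (f - g)
      = (contraction D B)^[m + 1] f - (contraction D B)^[m + 1] g := by
    have h := map_sub (contractionₗ D B ^ (m + 1)) f g
    simp only [Module.End.pow_apply] at h
    exact h
  rw [sub_dot, iterate_sub, iterate_contraction_loopVec_dot D hB,
    iterate_contraction_constVec_dot]
  change evalAtₗ κ _ = _
  rw [map_sub, map_add]
  change evalAt κ (dot (loopVec l) _) + _ - evalAt κ _ = _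
  rw [evalAt_loopVec_dot, add_sub_cancel_left, map_sum, Finset.mul_sum]
  refine Finset.sum_congr rfl fun b _ => ?_
  rw [map_smul, smul_eq_mul, mul_assoc]
  rfl

/-- `∂_a · ∂_b` commutes with multiplication by `k_l - κ_l` up to first-order terms, so each term of
the exponential series contributes only the contractions of this factor. -/
theorem wickMean_sub_dot (hB : B.IsSymm) (l : ι) (u : Vec ι n) :
    wickMean D B κ (dot (loopVec l - constVec (κ l)) u)
      = Complex.I / 2 * ∑ b, (B l b : ℂ) * wickMean D B κ (divergence D b u) := by
  set K := max (dot (loopVec l - constVec (κ l)) u).totalDegree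
    (Finset.univ.sup fun b => (divergence D b u).totalDegree) + 1
  have wickMean_divergence (b : ι) :
      wickMean D B κ (divergence D b u) = wickSum D B κ K (divergence D b u) := by
    have := Finset.le_sup (f := fun b => (divergence D b u).totalDegree) (Finset.mem_univ b)
    exact wickMean_eq_wickSum D B κ (by omega)
  have evalAt_eq_zero : evalAt κ (dot (loopVec l - constVec (κ l)) u) = 0 := by
    rw [sub_dot]
    exact (map_sub (eval _) _ _).trans (sub_eq_zero.mpr (evalAt_loopVec_dot κ l u))
  rw [wickMean_eq_wickSum D B κ (K := K + 1) (by omega), wickSum_apply, Finset.sum_range_succ',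
    Function.iterate_zero_apply, evalAt_eq_zero, mul_zero, add_zero]
  simp only [evalAt_iterate_contraction_sub_dot D κ hB, wickMean_divergence, wickSum_apply,
    Finset.mul_sum]
  rw [Finset.sum_comm]
  refine Finset.sum_congr rfl fun b _ => Finset.sum_congr rfl fun m _ => ?_
  have : (m : ℂ) + 1 ≠ 0 := Nat.cast_add_one_ne_zero m
  have : (m.factorial : ℂ) ≠ 0 := Nat.cast_ne_zero.mpr m.factorial_ne_zero
  rw [Nat.factorial_succ]
  push_cast
  field_simp
  ring

theorem wickMean_integration_by_parts {A : Matrix ι ι ℝ} (hA : A.IsSymm) (hdet : A.det ≠ 0)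
    (i : ι) (u : Vec ι n) :
    wickMean D A⁻¹ κ (divergence D i u + C (2 * Complex.I) *
      dot (∑ l, (C (A i l : ℂ) : Scalar ι n) • (loopVec l - constVec (κ l))) u) = 0 := by
  have inv_symm : (A⁻¹).IsSymm := by rw [Matrix.IsSymm, Matrix.transpose_nonsing_inv, hA.eq]
  have mul_inv (b : ι) : ∑ l, (A i l : ℂ) * (A⁻¹ l b : ℂ) = if i = b then 1 else 0 := by
    have h := congrFun₂ (Matrix.mul_nonsing_inv A (isUnit_iff_ne_zero.mpr hdet)) i b
    rw [Matrix.mul_apply, Matrix.one_apply] at h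
    simpa only [Complex.ofReal_sum, Complex.ofReal_mul, apply_ite Complex.ofReal,
      Complex.ofReal_one, Complex.ofReal_zero] using congrArg Complex.ofReal h
  have sum_means : ∑ l, (A i l : ℂ) * (Complex.I / 2 * ∑ b, (A⁻¹ l b : ℂ) *
        wickMean D A⁻¹ κ (divergence D b u))
      = Complex.I / 2 * wickMean D A⁻¹ κ (divergence D i u) :=
    calc _ = Complex.I / 2 * ∑ b, (∑ l, (A i l : ℂ) * (A⁻¹ l b : ℂ)) *
          wickMean D A⁻¹ κ (divergence D b u) := by
          simp only [Finset.mul_sum, Finset.sum_mul]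
          rw [Finset.sum_comm]
          exact Finset.sum_congr rfl fun _ _ => Finset.sum_congr rfl fun _ _ => by ring
      _ = _ := by simp [mul_inv]
  simp only [sum_dot, smul_dot, wickMean_add, wickMean_C_mul, wickMean_sum,
    wickMean_sub_dot D κ inv_symm, sum_means]
  linear_combination wickMean D A⁻¹ κ (divergence D i u) * Complex.I_mul_I

end WickMean

namespace Propagators

variable {ι : Type} [Fintype ι] [DecidableEq ι] {P n : ℕ} (Φ : Propagators ι P n)

theorem covDeriv_momentum (j : Fin P) (i : ι) (u : Vec ι n) :
    covDeriv i u (Φ.momentum j) = (C (Φ.coeff j i : ℂ) : Scalar ι n) • u := by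
  ext1 <;> funext <;>
    simp [covDeriv, momentum, Vec.add_loop, Vec.add_par, Vec.smul_loop, Vec.smul_par, dirDeriv_C]

theorem dirDeriv_denom (ε : ℝ) (j : Fin P) (i : ι) (u : Vec ι n) :
    dirDeriv i u (Φ.denom ε j) = -2 * C (Φ.coeff j i : ℂ) * dot (Φ.momentum j) u := by
  rw [denom, dirDeriv_sub, dirDeriv_C, dirDeriv_dot, covDeriv_momentum, smul_dot, dot_smul,
    dot_comm u]
  ring

omit [Fintype ι] [DecidableEq ι] in
theorem quadMatrix_isSymm (α : Fin P → ℝ) : (Φ.quadMatrix α).IsSymm :=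
  Matrix.IsSymm.ext fun _ _ => Finset.sum_congr rfl fun _ _ => mul_right_comm _ _ _

theorem quadMatrix_mul_center {α : Fin P → ℝ} (hdet : (Φ.quadMatrix α).det ≠ 0) :
    Φ.quadMatrix α * Matrix.of (Φ.center α) = -Matrix.of (Φ.linVec α) := by
  have center_eq : Matrix.of (Φ.center α) = -((Φ.quadMatrix α)⁻¹ * Matrix.of (Φ.linVec α)) := by
    ext l μ
    simp [center, Matrix.mul_apply]
  rw [center_eq, Matrix.mul_neg,
    Matrix.mul_nonsing_inv_cancel_left _ _ (isUnit_iff_ne_zero.mpr hdet)]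

/-- Both sides are half the `k_i`-gradient of `∑_j α_j q_j²`, on the right after completing the
square. -/
theorem sum_smul_momentum {α : Fin P → ℝ} (hdet : (Φ.quadMatrix α).det ≠ 0) (i : ι) :
    ∑ j, (C (α j * Φ.coeff j i : ℂ) : Scalar ι n) • Φ.momentum j
      = ∑ l, (C (Φ.quadMatrix α i l : ℂ) : Scalar ι n)
          • (loopVec l - constVec (Φ.center α l)) := by
  ext1
  · funext m
    simp only [Vec.sum_loop, Finset.sum_apply, Vec.smul_loop, Pi.smul_apply, smul_eq_mul,
      Vec.sub_loop, loopVec_loop, momentum, constVec, sub_zero,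
      sum_mul_delta_right, quadMatrix]
    simp
  · funext μ
    have h := congrFun₂ (Φ.quadMatrix_mul_center hdet) i μ
    simp only [Matrix.mul_apply, Matrix.of_apply, Matrix.neg_apply, linVec, Finset.sum_apply,
      Pi.smul_apply, smul_eq_mul] at h
    have h' := congrArg (fun x : ℝ => -(C (x : ℂ) : Scalar ι n)) h
    simpa [Vec.sum_par, Vec.smul_par, Vec.sub_par, momentum, constVec, loopVec] using h'.symm

theorem wickMean_total_derivative (ε : ℝ) (D : ℂ) {α : Fin P → ℝ}
    (hdet : (Φ.quadMatrix α).det ≠ 0) (i : ι) (u : Vec ι n) :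
    wickMean D (Φ.quadMatrix α)⁻¹ (Φ.center α) (divergence D i u
      - ∑ j, C (Complex.I * α j) * dirDeriv i u (Φ.denom ε j)) = 0 := by
  rw [← wickMean_integration_by_parts D (Φ.center α) (Φ.quadMatrix_isSymm α) hdet i u,
    ← Φ.sum_smul_momentum hdet, sub_eq_add_neg, sum_dot, Finset.mul_sum, ← Finset.sum_neg_distrib]
  congr 2
  refine Finset.sum_congr rfl fun j _ => ?_
  rw [smul_dot, dirDeriv_denom]
  simp only [C_mul, map_ofNat]
  ring

end Propagators

section Poles

variable {T : Type*}

/-- The functions with at most an `r`-fold pole along `δ = 0`: they are of the form `h / δ ^ r`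
with `h ∈ S` wherever `δ ≠ 0`, and unrestricted where `δ = 0`. -/
def poles (S : Subalgebra ℂ (T → ℂ)) (δ : T → ℂ) (r : ℕ) : Submodule ℂ (T → ℂ) where
  carrier := {g | ∃ h ∈ S, ∀ x, δ x ≠ 0 → g x = h x / δ x ^ r}
  zero_mem' := ⟨0, S.zero_mem, fun x _ => (zero_div (δ x ^ r)).symm⟩
  add_mem' := by
    rintro f g ⟨f', hf', hf⟩ ⟨g', hg', hg⟩
    exact ⟨f' + g', S.add_mem hf' hg', fun x hx => by
      rw [Pi.add_apply, Pi.add_apply, hf x hx, hg x hx, add_div]⟩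
  smul_mem' := by
    rintro a g ⟨g', hg', hg⟩
    exact ⟨a • g', S.smul_mem hg' a, fun x hx => by
      rw [Pi.smul_apply, Pi.smul_apply, hg x hx, smul_div_assoc]⟩

variable {S : Subalgebra ℂ (T → ℂ)} {δ : T → ℂ}

theorem mem_poles_zero {g : T → ℂ} (hg : g ∈ S) : g ∈ poles S δ 0 :=
  ⟨g, hg, fun x _ => by rw [pow_zero, div_one]⟩

instance poles_gradedMonoid : SetLike.GradedMonoid (poles S δ) where
  one_mem := mem_poles_zero S.one_mem
  mul_mem := by
    rintro r s f g ⟨f', hf', hf⟩ ⟨g', hg', hg⟩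
    exact ⟨f' * g', S.mul_mem hf' hg', fun x hx => by
      rw [Pi.mul_apply, Pi.mul_apply, hf x hx, hg x hx, div_mul_div_comm, pow_add]⟩

theorem poles_mono (hδ : δ ∈ S) : Monotone (poles S δ) := by
  intro r s hrs g
  obtain ⟨t, rfl⟩ := Nat.exists_eq_add_of_le hrs
  rintro ⟨h, hh, hg⟩
  refine ⟨h * δ ^ t, S.mul_mem hh (S.pow_mem hδ t), fun x hx => ?_⟩
  rw [hg x hx, Pi.mul_apply, Pi.pow_apply, pow_add, mul_div_mul_right _ _ (pow_ne_zero t hx)]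

variable {ι : Type} [Fintype ι] [DecidableEq ι]

theorem det_mem {M : T → Matrix ι ι ℝ} (hM : ∀ i j, (fun x => (M x i j : ℂ)) ∈ S) :
    (fun x => ((M x).det : ℂ)) ∈ S := by
  have det_eq : (fun x => ((M x).det : ℂ))
      = ∑ σ : Equiv.Perm ι, ((σ.sign : ℤ) : ℂ) • ∏ i, fun x => (M x (σ i) i : ℂ) := by
    funext x
    simp [Matrix.det_apply', Finset.sum_apply, Finset.prod_apply]
  rw [det_eq]
  exact S.sum_mem fun σ _ => S.smul_mem (S.prod_mem fun i _ => hM _ _) _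

theorem inv_mem_poles {M : T → Matrix ι ι ℝ} (hM : ∀ i j, (fun x => (M x i j : ℂ)) ∈ S)
    (i j : ι) : (fun x => ((M x)⁻¹ i j : ℂ)) ∈ poles S (fun x => ((M x).det : ℂ)) 1 := by
  refine ⟨fun x => ((M x).adjugate i j : ℂ), ?_, fun x _ => ?_⟩
  · simp only [Matrix.adjugate_apply]
    refine det_mem fun a b => ?_
    by_cases h : a = j
    · simp only [h, Matrix.updateRow_self]
      exact S.algebraMap_mem ((Pi.single i (1 : ℝ) : ι → ℝ) b : ℂ)
    · simpa only [Matrix.updateRow_ne h] using hM a b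
  · change ((M x)⁻¹ i j : ℂ) = ((M x).adjugate i j : ℂ) / ((M x).det : ℂ) ^ 1
    rw [Matrix.inv_def, Ring.inverse_eq_inv', Matrix.smul_apply, smul_eq_mul, pow_one,
      Complex.ofReal_mul, Complex.ofReal_inv, inv_mul_eq_div]

variable {n : ℕ} {κ : T → ι → Mink n} {B : T → Matrix ι ι ℝ}

omit [Fintype ι] [DecidableEq ι] in
theorem evalAt_mem_poles (hδ : δ ∈ S) (hκ : ∀ l μ, (fun x => (κ x l μ : ℂ)) ∈ poles S δ 1)
    (f : Scalar ι n) : (fun x => evalAt (κ x) f) ∈ poles S δ (2 * f.totalDegree) := by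
  have evalAt_X_mem (v : ScalarVar ι n) :
      (fun x => evalAt (κ x) (X v)) ∈ poles S δ 2 := by
    rcases v with z | ⟨l, μ⟩
    · induction z using Sym2.ind with
      | _ l m =>
        have evalAt_X_eq : (fun x => evalAt (κ x) (X (Sum.inl s(l, m)))) = ∑ μ,
            (metric μ : ℂ) • ((fun x => (κ x l μ : ℂ)) * fun x => (κ x m μ : ℂ)) := by
          funext x
          simp [evalAt, mdot, Finset.sum_apply, mul_assoc]
        rw [evalAt_X_eq]
        refine Submodule.sum_mem _ fun μ _ => Submodule.smul_mem _ _ ?_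
        have mul_mem := SetLike.mul_mem_graded (hκ l μ) (hκ m μ)
        rwa [one_add_one_eq_two] at mul_mem
    · simp only [evalAt, eval_X, Sum.elim_inr]
      exact poles_mono hδ one_le_two (hκ l μ)
  have evalAt_eq : (fun x => evalAt (κ x) f) = ∑ m ∈ f.support,
      f.coeff m • ∏ v ∈ m.support, (fun x => evalAt (κ x) (X v)) ^ m v := by
    funext x
    exact (eval_eq _ f).trans (by simp [evalAt, Finset.sum_apply, Finset.prod_apply])
  rw [evalAt_eq]
  refine Submodule.sum_mem _ fun m hm => Submodule.smul_mem _ _ (poles_mono hδ ?_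
    (SetLike.prod_pow_mem_graded _ _ _ m fun v _ => evalAt_X_mem v))
  simp only [smul_eq_mul, ← Finset.sum_mul]
  rw [mul_comm]
  exact Nat.mul_le_mul_left 2 (le_totalDegree hm)

theorem evalAt_iterate_contraction_mem_poles (hδ : δ ∈ S)
    (hκ : ∀ l μ, (fun x => (κ x l μ : ℂ)) ∈ poles S δ 1)
    (hB : ∀ i j, (fun x => (B x i j : ℂ)) ∈ poles S δ 1) (D : ℂ) (m : ℕ) {d : ℕ}
    {f : Scalar ι n} (hf : f.totalDegree ≤ d) :
    (fun x => evalAt (κ x) ((contraction D (B x))^[m] f)) ∈ poles S δ (m + 2 * d) := by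
  induction m generalizing f with
  | zero =>
    exact poles_mono hδ (by omega) (evalAt_mem_poles hδ hκ f)
  | succ m ih =>
    have iterate_eq : (fun x => evalAt (κ x) ((contraction D (B x))^[m + 1] f))
        = ∑ l, ∑ l', (fun x => (B x l l' : ℂ)) *
            fun x => evalAt (κ x) ((contraction D (B x))^[m] (divergence D l (grad l' f))) := by
      funext x
      have linear_apply (g : Scalar ι n) : (evalAtₗ (κ x) ∘ₗ contractionₗ D (B x) ^ m) g
          = evalAt (κ x) ((contraction D (B x))^[m] g) :=
        congrArg (evalAtₗ (κ x)) (Module.End.pow_apply (contractionₗ D (B x)) m g)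
      simp only [Finset.sum_apply, Pi.mul_apply, Function.iterate_succ_apply, ← linear_apply]
      rw [contraction]
      simp only [map_sum, ← smul_eq_C_mul, map_smul, smul_eq_mul]
    rw [iterate_eq, show m + 1 + 2 * d = 1 + (m + 2 * d) by omega]
    refine Submodule.sum_mem _ fun l _ => Submodule.sum_mem _ fun l' _ =>
      SetLike.mul_mem_graded (hB l l') (ih ?_)
    exact (totalDegree_divergence_le D l (totalDegree_grad_loop_le l' f)
      (totalDegree_grad_par_le l' f)).trans ((Nat.sub_le _ _).trans hf)

theorem wickMean_mem_poles (hδ : δ ∈ S) (hκ : ∀ l μ, (fun x => (κ x l μ : ℂ)) ∈ poles S δ 1)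
    (hB : ∀ i j, (fun x => (B x i j : ℂ)) ∈ poles S δ 1) (D : ℂ) {d : ℕ} {f : Scalar ι n}
    (hf : f.totalDegree ≤ d) : (fun x => wickMean D (B x) (κ x) f) ∈ poles S δ (3 * d) := by
  have wickMean_eq : (fun x => wickMean D (B x) (κ x) f) = ∑ m ∈ Finset.range (f.totalDegree + 1),
      ((Complex.I / 4) ^ m / (m.factorial : ℂ)) •
        fun x => evalAt (κ x) ((contraction D (B x))^[m] f) := by
    funext x
    simp [wickMean, Finset.sum_apply]
  rw [wickMean_eq]
  refine Submodule.sum_mem _ fun m hm => Submodule.smul_mem _ _ (poles_mono hδ ?_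
    (evalAt_iterate_contraction_mem_poles hδ hκ hB D m hf))
  rw [Finset.mem_range] at hm
  omega

end Poles

section PolyGrowth

variable {E : Type*} [NormedAddCommGroup E] [MeasurableSpace E]

variable (E) in
/-- The measurable functions that grow at most polynomially. -/
def polyGrowth : Subalgebra ℂ (E → ℂ) where
  carrier := {g | Measurable g ∧ ∃ (c : ℝ) (K : ℕ), ∀ x, ‖g x‖ ≤ c * (1 + ‖x‖) ^ K}
  mul_mem' := by
    rintro f g ⟨hf, c, K, hfc⟩ ⟨hg, c', K', hgc⟩
    refine ⟨hf.mul hg, c * c', K + K', fun x => ?_⟩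
    calc ‖f x * g x‖ = ‖f x‖ * ‖g x‖ := norm_mul _ _
      _ ≤ (c * (1 + ‖x‖) ^ K) * (c' * (1 + ‖x‖) ^ K') :=
        mul_le_mul (hfc x) (hgc x) (norm_nonneg _) ((norm_nonneg _).trans (hfc x))
      _ = c * c' * (1 + ‖x‖) ^ (K + K') := by ring
  add_mem' := by
    rintro f g ⟨hf, c, K, hfc⟩ ⟨hg, c', K', hgc⟩
    refine ⟨hf.add hg, |c| + |c'|, max K K', fun x => ?_⟩
    have one_le : 1 ≤ 1 + ‖x‖ := le_add_of_nonneg_right (norm_nonneg x)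
    calc ‖f x + g x‖ ≤ ‖f x‖ + ‖g x‖ := norm_add_le _ _
      _ ≤ c * (1 + ‖x‖) ^ K + c' * (1 + ‖x‖) ^ K' := add_le_add (hfc x) (hgc x)
      _ ≤ |c| * (1 + ‖x‖) ^ max K K' + |c'| * (1 + ‖x‖) ^ max K K' := by
        gcongr
        exacts [le_abs_self c, le_max_left K K', le_abs_self c', le_max_right K K']
      _ = (|c| + |c'|) * (1 + ‖x‖) ^ max K K' := by ring
  algebraMap_mem' a := ⟨measurable_const, ‖a‖, 0, fun x => by simp⟩

theorem mem_polyGrowth_of_norm_le {f g : E → ℂ} (hf : Measurable f) (hg : g ∈ polyGrowth E)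
    (hfg : ∀ x, ‖f x‖ ≤ ‖g x‖) : f ∈ polyGrowth E := by
  obtain ⟨-, c, K, hc⟩ := hg
  exact ⟨hf, c, K, fun x => (hfg x).trans (hc x)⟩

theorem norm_ofReal_cpow_le (t : ℝ) {z : ℂ} (hz : 0 ≤ z.re) :
    ‖(t : ℂ) ^ z‖ ≤ (1 + |t|) ^ ⌈z.re⌉₊ * Real.exp (Real.pi * |z.im|) := by
  refine (Complex.norm_cpow_le _ _).trans ?_
  rw [Complex.norm_real, Real.norm_eq_abs, div_eq_mul_inv, ← Real.exp_neg]
  refine mul_le_mul ?_ (Real.exp_le_exp.mpr ?_) (Real.exp_nonneg _) (by positivity)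
  · calc |t| ^ z.re ≤ (1 + |t|) ^ z.re :=
          Real.rpow_le_rpow (abs_nonneg t) (le_add_of_nonneg_left zero_le_one) hz
      _ ≤ (1 + |t|) ^ (⌈z.re⌉₊ : ℝ) :=
          Real.rpow_le_rpow_of_exponent_le (le_add_of_nonneg_right (abs_nonneg t)) (Nat.le_ceil _)
      _ = (1 + |t|) ^ ⌈z.re⌉₊ := Real.rpow_natCast _ _
  · calc -(Complex.arg t * z.im) ≤ |Complex.arg t * z.im| := neg_le_abs _
      _ = |Complex.arg t| * |z.im| := abs_mul _ _
      _ ≤ Real.pi * |z.im| := by gcongr; exact Complex.abs_arg_le_pi _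

theorem cpow_mem_polyGrowth {δ : E → ℝ} (hδ : (fun x => (δ x : ℂ)) ∈ polyGrowth E) {z : ℂ}
    (hz : 0 ≤ z.re) : (fun x => (δ x : ℂ) ^ z) ∈ polyGrowth E := by
  have abs_mem : (fun x => ((|δ x| : ℝ) : ℂ)) ∈ polyGrowth E := by
    have measurable_δ : Measurable δ := Complex.measurable_re.comp hδ.1
    exact mem_polyGrowth_of_norm_le (Complex.measurable_ofReal.comp measurable_δ.abs) hδ
      fun x => by simp
  have bound_mem := mul_mem (pow_mem (add_mem (one_mem (polyGrowth E)) abs_mem) ⌈z.re⌉₊)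
    ((polyGrowth E).algebraMap_mem (Real.exp (Real.pi * |z.im|) : ℂ))
  refine mem_polyGrowth_of_norm_le (hδ.1.pow_const z) bound_mem fun x => ?_
  refine (norm_ofReal_cpow_le (δ x) hz).trans_eq ?_
  have : (1 : ℂ) + (|δ x| : ℝ) = ((1 + |δ x| : ℝ) : ℂ) := by push_cast; rfl
  simp only [Pi.mul_apply, Pi.pow_apply, Pi.add_apply, Pi.one_apply, Pi.algebraMap_apply,
    Algebra.algebraMap_self, RingHom.id_apply, norm_mul, norm_pow, this, Complex.norm_real]
  rw [Real.norm_of_nonneg (by positivity), Real.norm_of_nonneg (by positivity)]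

theorem cpow_mul_mem_polyGrowth {δ : E → ℝ} (hδ : (fun x => (δ x : ℂ)) ∈ polyGrowth E) {r : ℕ}
    {g : E → ℂ} (hg : g ∈ poles (polyGrowth E) (fun x => (δ x : ℂ)) r) {z : ℂ} (hz : r < z.re) :
    (fun x => (δ x : ℂ) ^ z * g x) ∈ polyGrowth E := by
  obtain ⟨h, hh, hg⟩ := hg
  have re_pos : 0 < (z - r).re := by simpa using hz
  have cpow_mul_eq : (fun x => (δ x : ℂ) ^ z * g x)
      = (fun x => (δ x : ℂ) ^ (z - r)) * h := by
    funext x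
    rw [Pi.mul_apply]
    by_cases hx : (δ x : ℂ) = 0
    · have sub_ne_zero : z - r ≠ 0 := fun h => by simp [h] at re_pos
      have ne_zero : z ≠ 0 := by
        rintro rfl
        exact (Nat.cast_nonneg r).not_gt hz
      rw [hx, Complex.zero_cpow ne_zero, Complex.zero_cpow sub_ne_zero, zero_mul, zero_mul]
    · rw [hg x hx, Complex.cpow_sub _ _ hx, Complex.cpow_natCast, div_mul_eq_mul_div,
        mul_div_assoc]
  rw [cpow_mul_eq]
  exact mul_mem (cpow_mem_polyGrowth hδ re_pos.le) hh

end PolyGrowth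

section Orthant

open MeasureTheory

variable {J : Type*}

theorem setOf_forall_pos_eq_pi : {α : J → ℝ | ∀ j, 0 < α j} = Set.univ.pi fun _ => Set.Ioi 0 := by
  ext
  simp

theorem measurableSet_forall_pos [Countable J] : MeasurableSet {α : J → ℝ | ∀ j, 0 < α j} := by
  rw [setOf_forall_pos_eq_pi]
  exact MeasurableSet.univ_pi fun _ => measurableSet_Ioi

variable [Fintype J]

theorem integrableOn_exp_neg_mul_sum {ε : ℝ} (hε : 0 < ε) :
    IntegrableOn (fun α : J → ℝ => Real.exp (-(ε * ∑ j, α j))) {α | ∀ j, 0 < α j} := by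
  have integrable_prod := Integrable.fintype_prod (ι := J) (f := fun _ x => Real.exp (-ε * x))
    (μ := fun _ => (volume : Measure ℝ).restrict (Set.Ioi 0))
    fun _ => exp_neg_integrableOn_Ioi 0 hε
  rw [← Measure.restrict_pi_pi] at integrable_prod
  rw [setOf_forall_pos_eq_pi, IntegrableOn, volume_pi]
  simpa only [← Real.exp_sum, ← Finset.mul_sum, neg_mul, Finset.sum_neg_distrib]
    using integrable_prod

theorem one_add_pow_le_mul_exp {ε : ℝ} (hε : 0 < ε) (K : ℕ) {t : ℝ} (ht : 0 ≤ t) :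
    (1 + t) ^ K ≤ K.factorial * Real.exp ε / ε ^ K * Real.exp (ε * t) := by
  have pow_le := Real.pow_div_factorial_le_exp (x := ε * (1 + t)) (by positivity) K
  rw [div_le_iff₀ (by positivity), mul_pow, mul_one_add, Real.exp_add] at pow_le
  rw [div_mul_eq_mul_div, le_div_iff₀ (by positivity)]
  linarith

theorem integrableOn_polyGrowth_mul_cexp {g e : (J → ℝ) → ℂ} (hg : g ∈ polyGrowth (J → ℝ))
    (he : Measurable e) {ε : ℝ} (hε : 0 < ε) (hre : ∀ α, (e α).re = -(ε * ∑ j, α j)) :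
    IntegrableOn (fun α => g α * Complex.exp (e α)) {α | ∀ j, 0 < α j} := by
  obtain ⟨hgm, c, K, hgc⟩ := hg
  have c_nonneg : 0 ≤ c := by simpa using (norm_nonneg _).trans (hgc 0)
  refine ((integrableOn_exp_neg_mul_sum (half_pos hε)).const_mul
    (c * (K.factorial * Real.exp (ε / 2) / (ε / 2) ^ K))).mono'
    (hgm.mul he.cexp).aestronglyMeasurable ((ae_restrict_iff' measurableSet_forall_pos).mpr
      (Filter.Eventually.of_forall fun α hα => ?_))
  have norm_le_sum : ‖α‖ ≤ ∑ j, α j := by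
    refine (pi_norm_le_iff_of_nonneg (Finset.sum_nonneg fun j _ => (hα j).le)).mpr fun j => ?_
    rw [Real.norm_of_nonneg (hα j).le]
    exact Finset.single_le_sum (fun k _ => (hα k).le) (Finset.mem_univ j)
  calc ‖g α * Complex.exp (e α)‖ = ‖g α‖ * Real.exp (-(ε * ∑ j, α j)) := by
        rw [norm_mul, Complex.norm_exp, hre]
    _ ≤ c * (1 + ‖α‖) ^ K * Real.exp (-(ε * ∑ j, α j)) := by gcongr; exact hgc α
    _ ≤ c * (1 + ∑ j, α j) ^ K * Real.exp (-(ε * ∑ j, α j)) := by gcongr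
    _ ≤ c * (K.factorial * Real.exp (ε / 2) / (ε / 2) ^ K * Real.exp (ε / 2 * ∑ j, α j))
        * Real.exp (-(ε * ∑ j, α j)) := by
      gcongr
      exact one_add_pow_le_mul_exp (half_pos hε) K (Finset.sum_nonneg fun j _ => (hα j).le)
    _ = c * (K.factorial * Real.exp (ε / 2) / (ε / 2) ^ K)
        * Real.exp (-(ε / 2 * ∑ j, α j)) := by
      rw [← mul_assoc, mul_assoc _ (Real.exp _), ← Real.exp_add]
      ring_nf

theorem coord_mem_polyGrowth (j : J) : (fun α : J → ℝ => (α j : ℂ)) ∈ polyGrowth (J → ℝ) := by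
  refine ⟨by fun_prop, 1, 1, fun α => ?_⟩
  rw [one_mul, pow_one, Complex.norm_real]
  exact (norm_le_pi_norm α j).trans (le_add_of_nonneg_left zero_le_one)

end Orthant

/-- Extension by zero of the Schwinger parameters with index in `p`. -/
def extendZero {J : Type*} (p : J → Prop) [DecidablePred p] (α : {j // p j} → ℝ) (j : J) : ℝ :=
  if h : p j then α ⟨j, h⟩ else 0

section ExtendZero

variable {J : Type*} [Fintype J] (p : J → Prop) [DecidablePred p]

theorem sum_extendZero (α : {j // p j} → ℝ) : ∑ j, extendZero p α j = ∑ j, α j := by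
  have extendZero_coe (j : {j // p j}) : extendZero p α j = α j := dif_pos j.2
  have extendZero_not (j : {j // ¬ p j}) : extendZero p α j = 0 := dif_neg j.2
  rw [← Fintype.sum_subtype_add_sum_subtype p]
  simp only [extendZero_coe, extendZero_not, Finset.sum_const_zero, add_zero]

theorem extendZero_mem_polyGrowth (j : J) :
    (fun α => (extendZero p α j : ℂ)) ∈ polyGrowth ({j // p j} → ℝ) := by
  by_cases h : p j
  · simpa only [extendZero, dif_pos h] using coord_mem_polyGrowth (⟨j, h⟩ : {j // p j})
  · simp only [extendZero, dif_neg h, Complex.ofReal_zero]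
    exact (polyGrowth ({j // p j} → ℝ)).zero_mem

end ExtendZero

/-- The weight of the Schwinger parameters with index in `p`. -/
def schwingerWeight {J : Type*} [Fintype J] (p : J → Prop) [DecidablePred p] (ν : J → ℤ)
    (α : {j // p j} → ℝ) : ℂ :=
  ∏ j, Complex.I ^ ν j.1 * (α j : ℂ) ^ (ν j.1 - 1) / Complex.Gamma (ν j.1 : ℂ)

theorem schwingerWeight_mem_polyGrowth {J : Type*} [Fintype J] {p : J → Prop} [DecidablePred p]
    {ν : J → ℤ} (hν : ∀ j, p j → 0 < ν j) :
    schwingerWeight p ν ∈ polyGrowth ({j // p j} → ℝ) := by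
  have weight_eq : schwingerWeight p ν = ∏ j : {j // p j},
      (Complex.I ^ ν j.1 / Complex.Gamma (ν j.1 : ℂ)) •
        (fun α : {j // p j} → ℝ => (α j : ℂ)) ^ (ν j.1 - 1).toNat := by
    funext α
    simp only [schwingerWeight, Finset.prod_apply, Pi.smul_apply, Pi.pow_apply, smul_eq_mul]
    refine Finset.prod_congr rfl fun j _ => ?_
    rw [mul_div_right_comm, ← zpow_natCast, Int.toNat_of_nonneg (Int.le_sub_one_of_lt (hν j j.2))]
  rw [weight_eq]
  exact prod_mem fun j _ => (polyGrowth _).smul_mem (pow_mem (coord_mem_polyGrowth j) _) _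

namespace Propagators

open MeasureTheory

variable {ι : Type} {P n : ℕ} (Φ : Propagators ι P n)

section Poles

variable {T : Type*} {S : Subalgebra ℂ (T → ℂ)} {β : T → Fin P → ℝ}

theorem quadMatrix_mem (hβ : ∀ j, (fun x => (β x j : ℂ)) ∈ S) (l l' : ι) :
    (fun x => (Φ.quadMatrix (β x) l l' : ℂ)) ∈ S := by
  have quadMatrix_eq : (fun x => (Φ.quadMatrix (β x) l l' : ℂ))
      = ∑ j, ((Φ.coeff j l * Φ.coeff j l' : ℝ) : ℂ) • fun x => (β x j : ℂ) := by
    funext x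
    simp [quadMatrix, Finset.sum_apply, mul_assoc, mul_comm (β x _ : ℂ)]
  rw [quadMatrix_eq]
  exact S.sum_mem fun j _ => S.smul_mem (hβ j) _

theorem linVec_mem (hβ : ∀ j, (fun x => (β x j : ℂ)) ∈ S) (l : ι) (μ : Fin (n + 1)) :
    (fun x => (Φ.linVec (β x) l μ : ℂ)) ∈ S := by
  have linVec_eq : (fun x => (Φ.linVec (β x) l μ : ℂ))
      = ∑ j, ((Φ.coeff j l * Φ.shift j μ : ℝ) : ℂ) • fun x => (β x j : ℂ) := by
    funext x
    simp [linVec, Finset.sum_apply, mul_assoc, mul_comm (β x _ : ℂ)]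
  rw [linVec_eq]
  exact S.sum_mem fun j _ => S.smul_mem (hβ j) _

variable [Fintype ι] [DecidableEq ι]

theorem center_mem_poles (hβ : ∀ j, (fun x => (β x j : ℂ)) ∈ S) (l : ι) (μ : Fin (n + 1)) :
    (fun x => (Φ.center (β x) l μ : ℂ))
      ∈ poles S (fun x => ((Φ.quadMatrix (β x)).det : ℂ)) 1 := by
  have center_eq : (fun x => (Φ.center (β x) l μ : ℂ))
      = -∑ l', (fun x => ((Φ.quadMatrix (β x))⁻¹ l l' : ℂ)) *
          fun x => (Φ.linVec (β x) l' μ : ℂ) := by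
    funext x
    simp [center, Finset.sum_apply]
  rw [center_eq]
  refine Submodule.neg_mem _ (Submodule.sum_mem _ fun l' _ => ?_)
  have mul_mem := SetLike.mul_mem_graded (inv_mem_poles (Φ.quadMatrix_mem hβ) l l')
    (mem_poles_zero (Φ.linVec_mem hβ l' μ))
  rwa [add_zero] at mul_mem

end Poles

section Gauss

variable [Fintype ι] [DecidableEq ι]

/-- The value of `-i ∑_j α_j (m_j^2 - q_j^2 - iε)` at the stationary point. -/
def gaussExponent (ε : ℝ) (α : Fin P → ℝ) : ℂ :=
  -Complex.I * (∑ j, (α j : ℂ) *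
      ((Φ.massSq j : ℂ) - mdot (Φ.shift j) (Φ.shift j) - Complex.I * ε))
    - Complex.I * ∑ l, ∑ l',
      ((Φ.quadMatrix α)⁻¹ l l' * mdot (Φ.linVec α l) (Φ.linVec α l') : ℝ)

theorem gaussExponent_re (ε : ℝ) (α : Fin P → ℝ) :
    (Φ.gaussExponent ε α).re = -(ε * ∑ j, α j) := by
  simp only [gaussExponent, neg_mul, Complex.sub_re, Complex.neg_re, Complex.I_mul_re,
    Complex.ofReal_im, Complex.im_sum, Complex.im_ofReal_mul, Complex.sub_im, Complex.I_mul_im,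
    Complex.ofReal_re]
  simp [Finset.mul_sum, mul_comm]

omit [Fintype ι] [DecidableEq ι] in
theorem continuous_quadMatrix : Continuous (Φ.quadMatrix) := by
  refine continuous_matrix fun l l' => ?_
  simp only [quadMatrix]
  fun_prop

omit [Fintype ι] [DecidableEq ι] in
theorem continuous_mdot_linVec (l l' : ι) :
    Continuous fun α => mdot (Φ.linVec α l) (Φ.linVec α l') := by
  simp only [mdot, linVec, Finset.sum_apply, Pi.smul_apply, smul_eq_mul]
  fun_prop

theorem measurable_inv_quadMatrix (l l' : ι) :
    Measurable fun α => (Φ.quadMatrix α)⁻¹ l l' := by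
  simp only [Matrix.inv_def, Ring.inverse_eq_inv', Matrix.smul_apply, smul_eq_mul]
  exact Φ.continuous_quadMatrix.matrix_det.measurable.inv.mul
    (Φ.continuous_quadMatrix.matrix_adjugate.matrix_elem l l').measurable

theorem measurable_gaussExponent (ε : ℝ) : Measurable (Φ.gaussExponent ε) := by
  have measurable_quad (l l' : ι) : Measurable fun α =>
      (Φ.quadMatrix α)⁻¹ l l' * mdot (Φ.linVec α l) (Φ.linVec α l') :=
    (Φ.measurable_inv_quadMatrix l l').mul (Φ.continuous_mdot_linVec l l').measurable
  unfold gaussExponent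
  fun_prop

/-- The Schwinger parametric integrand with parameters for the indices in `p`. -/
def schwingerOn (p : Fin P → Prop) [DecidablePred p] (ε : ℝ) (D : ℂ) (ν : Fin P → ℤ)
    (f : Scalar ι n) (α : {j // p j} → ℝ) : ℂ :=
  schwingerWeight p ν α * Φ.gaussIntegral ε D (extendZero p α) f

theorem integrableOn_schwingerOn {p : Fin P → Prop} [DecidablePred p] {ε : ℝ} (hε : 0 < ε)
    {ν : Fin P → ℤ} (hν : ∀ j, p j → 0 < ν j) {d : ℕ} {f : Scalar ι n}
    (hf : f.totalDegree ≤ d) {D : ℂ} (hD : D.re < -(6 * d)) :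
    IntegrableOn (Φ.schwingerOn p ε D ν f) {α | ∀ j, 0 < α j} := by
  have quadMatrix_mem := Φ.quadMatrix_mem (extendZero_mem_polyGrowth p)
  have wickMean_mem := wickMean_mem_poles (det_mem quadMatrix_mem)
    (Φ.center_mem_poles (extendZero_mem_polyGrowth p)) (inv_mem_poles quadMatrix_mem) D hf
  have three_mul_lt : ((3 * d : ℕ) : ℝ) < (-D / 2).re := by
    rw [Complex.div_ofNat_re, Complex.neg_re]
    push_cast
    linarith
  have growth := (polyGrowth _).smul_mem (mul_mem (schwingerWeight_mem_polyGrowth hν)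
    (cpow_mul_mem_polyGrowth (det_mem quadMatrix_mem) wickMean_mem three_mul_lt))
    ((Complex.I * (Real.pi : ℂ) ^ (D / 2) * Complex.exp (-(Real.pi * Complex.I * D / 4)))
      ^ Fintype.card ι)
  have measurable_extendZero : Measurable (extendZero p) := measurable_pi_iff.mpr fun j =>
    Complex.measurable_re.comp (extendZero_mem_polyGrowth p j).1
  refine (integrableOn_polyGrowth_mul_cexp growth
    ((Φ.measurable_gaussExponent ε).comp measurable_extendZero) hε fun α => ?_).congr_fun
    (fun α _ => ?_) measurableSet_forall_pos
  · rw [Function.comp_apply, gaussExponent_re, sum_extendZero]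
  · simp only [schwingerOn, gaussIntegral, Function.comp_apply, gaussExponent, Pi.smul_apply,
      Pi.mul_apply, smul_eq_mul]
    ring

end Gauss

end Propagators

theorem derivation_prod {R A M τ : Type*} [CommSemiring R] [CommSemiring A] [AddCommMonoid M]
    [Algebra R A] [Module A M] [Module R M] [DecidableEq τ] (d : Derivation R A M) (s : Finset τ)
    (f : τ → A) : d (∏ x ∈ s, f x) = ∑ x ∈ s, (∏ y ∈ s.erase x, f y) • d (f x) := by
  induction s using Finset.induction_on with
  | empty => simp
  | insert a s ha ih =>
    rw [Finset.prod_insert ha, d.leibniz, ih, Finset.sum_insert ha, Finset.erase_insert ha,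
      Finset.smul_sum, add_comm]
    congr 1
    refine Finset.sum_congr rfl fun x hx => ?_
    rw [Finset.erase_insert_of_ne (ne_of_mem_of_not_mem hx ha).symm,
      Finset.prod_insert fun h => ha (Finset.mem_of_mem_erase h), smul_smul]

section SchwingerWeight

variable {J : Type*} [Fintype J] [DecidableEq J] {p : J → Prop} [DecidablePred p] {j : J}

theorem schwingerWeight_add_single_of_not (hj : ¬ p j) (ν : J → ℤ) (α : {j // p j} → ℝ) :
    schwingerWeight p (ν + Pi.single j 1) α = schwingerWeight p ν α := by
  refine Finset.prod_congr rfl fun k _ => ?_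
  have ne : k.1 ≠ j := fun h => hj (h ▸ k.2)
  simp [Pi.single_eq_of_ne ne]

theorem schwingerWeight_add_single (hj : p j) {ν : J → ℤ} (hν : ν j ≠ 0) {α : {j // p j} → ℝ}
    (hα : α ⟨j, hj⟩ ≠ 0) : schwingerWeight p (ν + Pi.single j 1) α
      = schwingerWeight p ν α * (Complex.I * α ⟨j, hj⟩ / ν j) := by
  have others (k : {j // p j}) (hk : k ≠ ⟨j, hj⟩) : (ν + Pi.single j 1 : J → ℤ) k.1 = ν k.1 := by
    rw [Pi.add_apply, Pi.single_eq_of_ne fun h => hk (Subtype.ext h), add_zero]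
  have hν' : (ν j : ℂ) ≠ 0 := Int.cast_ne_zero.mpr hν
  have hα' : (α ⟨j, hj⟩ : ℂ) ≠ 0 := Complex.ofReal_ne_zero.mpr hα
  rw [schwingerWeight, schwingerWeight, ← Finset.mul_prod_erase _ _ (Finset.mem_univ ⟨j, hj⟩),
    ← Finset.mul_prod_erase Finset.univ _ (Finset.mem_univ (⟨j, hj⟩ : {j // p j})),
    Finset.prod_congr rfl fun k hk => by rw [others k (Finset.ne_of_mem_erase hk)],
    Pi.add_apply, Pi.single_eq_same, zpow_add_one₀ Complex.I_ne_zero, add_sub_right_comm,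
    zpow_add_one₀ hα', Int.cast_add, Int.cast_one, Complex.Gamma_add_one _ hν']
  simp only [div_eq_mul_inv, mul_inv]
  ring

end SchwingerWeight

namespace Propagators

open MeasureTheory

variable {ι : Type} [Fintype ι] {P n : ℕ} (Φ : Propagators ι P n)

/-- The factor `X_j^{-ν_j}` of the integrand when `ν_j ≤ 0`, and `1` when `X_j` is
exponentiated. -/
def numeratorFactor (ε : ℝ) (ν : Fin P → ℤ) (j : Fin P) : Scalar ι n :=
  if 0 < ν j then 1 else Φ.denom ε j ^ (-ν j).toNat

theorem numeratorFactor_of_pos (ε : ℝ) {ν : Fin P → ℤ} {j : Fin P} (hj : 0 < ν j) :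
    Φ.numeratorFactor ε ν j = 1 := if_pos hj

theorem numeratorFactor_of_nonpos (ε : ℝ) {ν : Fin P → ℤ} {j : Fin P} (hj : ν j ≤ 0) :
    Φ.numeratorFactor ε ν j = Φ.denom ε j ^ (-ν j).toNat := if_neg hj.not_gt

theorem numeratorFactor_add_single_of_ne (ε : ℝ) (ν : Fin P → ℤ) {j k : Fin P} (h : k ≠ j) :
    Φ.numeratorFactor ε (ν + Pi.single j 1) k = Φ.numeratorFactor ε ν k := by
  simp only [numeratorFactor, Pi.add_apply, Pi.single_eq_of_ne h, add_zero]

/-- The polynomial `N ∏_{ν_j ≤ 0} X_j^{-ν_j}` that is integrated against the Gaussian. -/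
def fullNumerator (ε : ℝ) (ν : Fin P → ℤ) (N : Scalar ι n) : Scalar ι n :=
  N * ∏ j, Φ.numeratorFactor ε ν j

theorem fullNumerator_add_single_of_pos (ε : ℝ) {ν : Fin P → ℤ} {j : Fin P} (hj : 0 < ν j)
    (N : Scalar ι n) : Φ.fullNumerator ε (ν + Pi.single j 1) N = Φ.fullNumerator ε ν N := by
  refine congrArg (N * ·) (Finset.prod_congr rfl fun k _ => ?_)
  rcases eq_or_ne k j with rfl | hk
  · rw [numeratorFactor_of_pos Φ ε hj, numeratorFactor_of_pos]
    simp only [Pi.add_apply, Pi.single_eq_same]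
    omega
  · exact Φ.numeratorFactor_add_single_of_ne ε ν hk

variable [DecidableEq ι]

theorem dirDeriv_numeratorFactor (ε : ℝ) {ν : Fin P → ℤ} {j : Fin P} (hj : ν j ≤ 0) (i : ι)
    (v : Vec ι n) : dirDeriv i v (Φ.numeratorFactor ε ν j)
      = -(C (ν j : ℂ) * Φ.numeratorFactor ε (ν + Pi.single j 1) j
          * dirDeriv i v (Φ.denom ε j)) := by
  rw [numeratorFactor_of_nonpos Φ ε hj, ← dirDerivation_apply, Derivation.leibniz_pow,
    dirDerivation_apply, smul_eq_mul, nsmul_eq_mul]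
  rcases hj.eq_or_lt with h | h
  · simp [h]
  · have exponent_le : (ν + Pi.single j 1 : Fin P → ℤ) j ≤ 0 := by simpa using h
    have exponent_eq : (-(ν + Pi.single j 1 : Fin P → ℤ) j).toNat = (-ν j).toNat - 1 := by
      simp only [Pi.add_apply, Pi.single_eq_same]
      omega
    have cast_eq : ((-ν j).toNat : Scalar ι n) = -C (ν j : ℂ) := by
      rw [← Int.cast_natCast, Int.toNat_of_nonneg (by omega)]
      simp
    rw [numeratorFactor_of_nonpos Φ ε exponent_le, exponent_eq, cast_eq]
    ring

theorem fullNumerator_add_single_of_nonpos (ε : ℝ) {ν : Fin P → ℤ} {j : Fin P} (hj : ν j ≤ 0)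
    (i : ι) (v : Vec ι n) (N : Scalar ι n) : Φ.fullNumerator ε (ν + Pi.single j 1)
        (-(C (ν j : ℂ) * N * dirDeriv i v (Φ.denom ε j)))
      = N * ((∏ k ∈ Finset.univ.erase j, Φ.numeratorFactor ε ν k)
        * dirDeriv i v (Φ.numeratorFactor ε ν j)) := by
  rw [fullNumerator, ← Finset.mul_prod_erase Finset.univ _ (Finset.mem_univ j),
    Finset.prod_congr rfl fun k hk =>
      Φ.numeratorFactor_add_single_of_ne ε ν (Finset.ne_of_mem_erase hk),
    dirDeriv_numeratorFactor Φ ε hj]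
  ring

theorem dirDeriv_fullNumerator (ε : ℝ) (ν : Fin P → ℤ) (i : ι) (v : Vec ι n) (N : Scalar ι n) :
    dirDeriv i v (Φ.fullNumerator ε ν N) = Φ.fullNumerator ε ν (dirDeriv i v N)
      + ∑ j, N * ((∏ k ∈ Finset.univ.erase j, Φ.numeratorFactor ε ν k)
        * dirDeriv i v (Φ.numeratorFactor ε ν j)) := by
  have prod_rule := derivation_prod (dirDerivation i v) Finset.univ (Φ.numeratorFactor ε ν)
  simp only [dirDerivation_apply, smul_eq_mul] at prod_rule
  rw [fullNumerator, dirDeriv_mul, prod_rule, ← Finset.mul_sum, fullNumerator]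
  ring

/-- The Gaussian integral as a linear functional. -/
def gaussIntegralₗ (ε : ℝ) (D : ℂ) (α : Fin P → ℝ) : Scalar ι n →ₗ[ℂ] ℂ where
  toFun := Φ.gaussIntegral ε D α
  map_add' f g := by simp only [gaussIntegral, wickMean_add, mul_add]
  map_smul' r f := by
    rw [smul_eq_C_mul, gaussIntegral, wickMean_C_mul, mul_left_comm]
    rfl

theorem gaussIntegral_C_mul (ε : ℝ) (D : ℂ) (α : Fin P → ℝ) (r : ℂ) (f : Scalar ι n) :
    Φ.gaussIntegral ε D α (C r * f) = r * Φ.gaussIntegral ε D α f := by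
  rw [← smul_eq_C_mul]
  exact map_smul (Φ.gaussIntegralₗ ε D α) r f

theorem gaussIntegral_total_derivative (ε : ℝ) {D : ℂ} (hD : D ≠ 0) (α : Fin P → ℝ) (i : ι)
    (u : Vec ι n) : Φ.gaussIntegral ε D α (divergence D i u
      - ∑ j, C (Complex.I * α j) * dirDeriv i u (Φ.denom ε j)) = 0 := by
  by_cases hdet : (Φ.quadMatrix α).det = 0
  · rw [gaussIntegral, hdet, Complex.ofReal_zero, Complex.zero_cpow (by simpa using hD)]
    simp
  · rw [gaussIntegral, Φ.wickMean_total_derivative ε D hdet, mul_zero]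

theorem schwinger_eq (ε : ℝ) (D : ℂ) (ν : Fin P → ℤ) (N : Scalar ι n) :
    Φ.schwinger ε D ν N = Φ.schwingerOn (fun j => 0 < ν j) ε D ν (Φ.fullNumerator ε ν N) := rfl

theorem schwingerOn_zero (p : Fin P → Prop) [DecidablePred p] (ε : ℝ) (D : ℂ) (ν : Fin P → ℤ)
    (α : {j // p j} → ℝ) : Φ.schwingerOn p ε D ν 0 α = 0 :=
  mul_eq_zero_of_right _ (map_zero (Φ.gaussIntegralₗ ε D _))

theorem schwinger_zero (ε : ℝ) (D : ℂ) (ν : Fin P → ℤ) (α : {j // 0 < ν j} → ℝ) :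
    Φ.schwinger ε D ν 0 α = 0 := by
  rw [schwinger_eq, fullNumerator, zero_mul, schwingerOn_zero]

theorem setIntegral_schwinger {p : Fin P → Prop} [DecidablePred p] {ν : Fin P → ℤ}
    (hp : ∀ j, 0 < ν j ↔ p j) (ε : ℝ) (D : ℂ) (N : Scalar ι n) :
    ∫ α in {α | ∀ j, 0 < α j}, Φ.schwinger ε D ν N α
      = ∫ α in {α | ∀ j, 0 < α j}, Φ.schwingerOn p ε D ν (Φ.fullNumerator ε ν N) α := by
  obtain rfl : (fun j => 0 < ν j) = p := funext fun j => propext (hp j)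
  rw [schwinger_eq]
  congr!

/-- The exponents of the terms of the total derivative of `N / ∏_j X_j^{ν_j}`: `none` is the term
in which the numerator is differentiated, and `some j` the one in which `X_j` is. -/
def termExponent (ν : Fin P → ℤ) : Option (Fin P) → Fin P → ℤ
  | none => ν
  | some j => ν + Pi.single j 1

/-- The numerators of the terms of the total derivative, indexed as in `termExponent`. -/
def termNumerator (ε : ℝ) (D : ℂ) (i : ι) (v : Vec ι n) (N : Scalar ι n) (ν : Fin P → ℤ) :
    Option (Fin P) → Scalar ι n
  | none => divergence D i v * N + dirDeriv i v N
  | some j => -(C (ν j : ℂ) * N * dirDeriv i v (Φ.denom ε j))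

theorem termExponent_injective (ν : Fin P → ℤ) : Function.Injective (termExponent ν) := by
  have single_ne_zero (j : Fin P) : (Pi.single j 1 : Fin P → ℤ) ≠ 0 := by simp
  rintro (_ | j) (_ | k) h
  · rfl
  · exact absurd (left_eq_add.mp h) (single_ne_zero k)
  · exact absurd (add_eq_left.mp h) (single_ne_zero j)
  · refine congrArg some (by_contra fun ne => ?_)
    simpa [Pi.single_eq_of_ne ne] using congrFun (add_left_cancel h) j

theorem totalDeriv_eq_mapDomain (ε : ℝ) (D : ℂ) (i : ι) (v : Vec ι n) (N : Scalar ι n)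
    (ν : Fin P → ℤ) : Φ.totalDeriv ε D i v N ν = Finsupp.mapDomain (termExponent ν)
      (Finsupp.equivFunOnFinite.symm (Φ.termNumerator ε D i v N ν)) := by
  rw [Finsupp.mapDomain, Finsupp.sum_fintype _ _ fun _ => Finsupp.single_zero _,
    Fintype.sum_option]
  rfl

/-- For `ν_j > 0` the derivative of `X_j^{-ν_j}` and that of `e^{-iα_j X_j}` have the same
Schwinger integrand, as raising `ν_j` multiplies the weight by `iα_j / ν_j`. -/
theorem schwingerOn_termNumerator_some (ε : ℝ) (D : ℂ) (ν : Fin P → ℤ) (i : ι) (v : Vec ι n)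
    (N : Scalar ι n) {α : {j // 0 < ν j} → ℝ} (hα : ∀ j, 0 < α j) (j : Fin P) :
    Φ.schwingerOn (fun j => 0 < ν j) ε D (ν + Pi.single j 1)
      (Φ.fullNumerator ε (ν + Pi.single j 1) (-(C (ν j : ℂ) * N * dirDeriv i v (Φ.denom ε j)))) α
      = Φ.schwingerOn (fun j => 0 < ν j) ε D ν
        (N * ((∏ k ∈ Finset.univ.erase j, Φ.numeratorFactor ε ν k)
            * dirDeriv i v (Φ.numeratorFactor ε ν j))
          - C (Complex.I * extendZero (fun j => 0 < ν j) α j) *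
            dirDeriv i (Φ.fullNumerator ε ν N • v) (Φ.denom ε j)) α := by
  rcases le_or_gt (ν j) 0 with h | h
  · rw [fullNumerator_add_single_of_nonpos Φ ε h, extendZero, dif_neg h.not_gt, schwingerOn,
      schwingerWeight_add_single_of_not (p := fun j => 0 < ν j) h.not_gt]
    simp [schwingerOn]
  · have cast_ne_zero : (ν j : ℂ) ≠ 0 := Int.cast_ne_zero.mpr h.ne'
    have numerator_eq : Φ.fullNumerator ε ν (-(C (ν j : ℂ) * N * dirDeriv i v (Φ.denom ε j)))
        = C (-ν j : ℂ) * (Φ.fullNumerator ε ν N * dirDeriv i v (Φ.denom ε j)) := by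
      simp only [fullNumerator, C_neg]
      ring
    have dirDeriv_one : dirDeriv i v (1 : Scalar ι n) = 0 := dirDeriv_C i v 1
    rw [fullNumerator_add_single_of_pos Φ ε h, numerator_eq, numeratorFactor_of_pos Φ ε h,
      dirDeriv_one, mul_zero, mul_zero, zero_sub, ← neg_mul, ← C_neg, smul_dirDeriv, extendZero,
      dif_pos h, schwingerOn, schwingerOn, gaussIntegral_C_mul, gaussIntegral_C_mul,
      schwingerWeight_add_single (p := fun j => 0 < ν j) h h.ne' (hα ⟨j, h⟩).ne']
    field_simp

theorem sum_schwingerOn_termNumerator (ε : ℝ) {D : ℂ} (hD : D ≠ 0) (ν : Fin P → ℤ) (i : ι)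
    (v : Vec ι n) (N : Scalar ι n) {α : {j // 0 < ν j} → ℝ} (hα : ∀ j, 0 < α j) :
    ∑ o, Φ.schwingerOn (fun j => 0 < ν j) ε D (termExponent ν o)
      (Φ.fullNumerator ε (termExponent ν o) (Φ.termNumerator ε D i v N ν o)) α = 0 := by
  have divergence_eq : divergence D i (Φ.fullNumerator ε ν N • v)
      = Φ.fullNumerator ε ν (divergence D i v * N + dirDeriv i v N)
        + ∑ j, N * ((∏ k ∈ Finset.univ.erase j, Φ.numeratorFactor ε ν k)
          * dirDeriv i v (Φ.numeratorFactor ε ν j)) := by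
    rw [divergence_smul, dirDeriv_fullNumerator]
    simp only [fullNumerator]
    ring
  have integral_eq_zero := Φ.gaussIntegral_total_derivative ε hD
    (extendZero (fun j => 0 < ν j) α) i (Φ.fullNumerator ε ν N • v)
  rw [divergence_eq, add_sub_assoc, ← Finset.sum_sub_distrib] at integral_eq_zero
  simp only [Fintype.sum_option, termExponent, termNumerator,
    schwingerOn_termNumerator_some Φ ε D ν i v N hα]
  simp only [schwingerOn, ← Finset.mul_sum, ← mul_add]
  refine mul_eq_zero_of_right _ (Eq.trans ?_ integral_eq_zero)
  change Φ.gaussIntegralₗ ε D _ _ + ∑ j, Φ.gaussIntegralₗ ε D _ _ = Φ.gaussIntegralₗ ε D _ _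
  rw [map_add, map_sum]

theorem setIntegral_schwinger_termNumerator (ε : ℝ) (D : ℂ) (i : ι) (v : Vec ι n)
    (N : Scalar ι n) (ν : Fin P → ℤ) (o : Option (Fin P)) :
    ∫ α in {α | ∀ j, 0 < α j},
        Φ.schwinger ε D (termExponent ν o) (Φ.termNumerator ε D i v N ν o) α
      = ∫ α in {α | ∀ j, 0 < α j}, Φ.schwingerOn (fun j => 0 < ν j) ε D (termExponent ν o)
        (Φ.fullNumerator ε (termExponent ν o) (Φ.termNumerator ε D i v N ν o)) α := by
  rcases o with _ | j
  · rfl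
  rcases eq_or_ne (ν j) 0 with h | h
  · have numerator_eq_zero : Φ.termNumerator ε D i v N ν (some j) = 0 := by
      simp [termNumerator, h]
    simp only [numerator_eq_zero, schwinger_zero, fullNumerator, zero_mul, schwingerOn_zero,
      integral_zero]
  · refine Φ.setIntegral_schwinger (fun k => ?_) ε D _
    rcases eq_or_ne k j with rfl | hk
    · simp only [termExponent, Pi.add_apply, Pi.single_eq_same]
      omega
    · simp only [termExponent, Pi.add_apply, Pi.single_eq_of_ne hk, add_zero]

theorem integrableOn_schwinger {ε : ℝ} (hε : 0 < ε) {ν : Fin P → ℤ} {N : Scalar ι n} {d : ℕ}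
    (hN : (Φ.fullNumerator ε ν N).totalDegree ≤ d) {D : ℂ} (hD : D.re < -(6 * d)) :
    IntegrableOn (Φ.schwinger ε D ν N) {α | ∀ j, 0 < α j} :=
  Φ.integrableOn_schwingerOn hε (fun _ h => h) hN hD

theorem sum_setIntegral_schwinger_termNumerator {ε : ℝ} (hε : 0 < ε) {D : ℂ} (i : ι)
    (v : Vec ι n) {N : Scalar ι n} {ν : Fin P → ℤ} {d : ℕ}
    (hd : ∀ o, (Φ.fullNumerator ε (termExponent ν o)
      (Φ.termNumerator ε D i v N ν o)).totalDegree ≤ d) (hD : D.re < -(6 * d)) :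
    ∑ o, ∫ α in {α | ∀ j, 0 < α j},
      Φ.schwinger ε D (termExponent ν o) (Φ.termNumerator ε D i v N ν o) α = 0 := by
  have termExponent_pos (o : Option (Fin P)) (j : Fin P) (hj : 0 < ν j) :
      0 < termExponent ν o j := by
    rcases o with _ | k
    · exact hj
    · exact hj.trans_le (le_add_of_nonneg_right ((Pi.single_nonneg.mpr zero_le_one :
        (0 : Fin P → ℤ) ≤ Pi.single k 1) j))
  have ne_zero : D ≠ 0 := by
    rintro rfl
    exact absurd hD (by simp)
  simp only [setIntegral_schwinger_termNumerator]
  rw [← integral_finsetSum _ fun o _ =>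
    Φ.integrableOn_schwingerOn hε (termExponent_pos o) (hd o) hD]
  exact setIntegral_eq_zero_of_forall_eq_zero fun α hα =>
    Φ.sum_schwingerOn_termNumerator ε ne_zero ν i v N hα

end Propagators

section BoundedDegree

/-- The families of polynomials of bounded total degree. -/
def boundedDegree (X σ R : Type*) [CommSemiring R] :
    Subalgebra (MvPolynomial σ R) (X → MvPolynomial σ R) where
  carrier := {f | ∃ d, ∀ x, (f x).totalDegree ≤ d}
  add_mem' := by
    rintro f g ⟨a, ha⟩ ⟨b, hb⟩
    exact ⟨max a b, fun x => totalDegree_add_le_of_le ((ha x).trans (le_max_left a b))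
      ((hb x).trans (le_max_right a b))⟩
  mul_mem' := by
    rintro f g ⟨a, ha⟩ ⟨b, hb⟩
    exact ⟨a + b, fun x => totalDegree_mul_le_of_le (ha x) (hb x)⟩
  algebraMap_mem' f := ⟨f.totalDegree, fun _ => le_rfl⟩

variable {X : Type*} {ι : Type} {n : ℕ}

theorem const_mem_boundedDegree (f : Scalar ι n) :
    (fun _ => f) ∈ boundedDegree X (ScalarVar ι n) ℂ :=
  (boundedDegree X (ScalarVar ι n) ℂ).algebraMap_mem f

variable [Fintype ι] [DecidableEq ι]

theorem dirDeriv_mem_boundedDegree (i : ι) (v : Vec ι n) {f : X → Scalar ι n}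
    (hf : f ∈ boundedDegree X (ScalarVar ι n) ℂ) :
    (fun x => dirDeriv i v (f x)) ∈ boundedDegree X (ScalarVar ι n) ℂ := by
  obtain ⟨d, hd⟩ := hf
  have dirDeriv_eq : (fun x => dirDeriv i v (f x))
      = (∑ l, (fun _ => v.loop l) * fun x => dirDeriv i (loopVec l) (f x))
        + ∑ μ, (fun _ => v.par μ) * fun x => dirDeriv i (basisVec μ) (f x) := by
    funext x
    simp only [dirDeriv_eq_sum i v, Pi.add_apply, Finset.sum_apply, Pi.mul_apply]
  have grad_loop_le (x : X) (l : ι) : ((grad i (f x)).loop l).totalDegree ≤ d :=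
    (totalDegree_grad_loop_le i (f x) l).trans ((Nat.sub_le _ _).trans (hd x))
  have grad_par_le (x : X) (μ : Fin (n + 1)) : ((grad i (f x)).par μ).totalDegree ≤ d :=
    (totalDegree_grad_par_le i (f x) μ).trans ((Nat.sub_le _ _).trans (hd x))
  rw [dirDeriv_eq]
  exact add_mem
    (sum_mem fun l _ => mul_mem (const_mem_boundedDegree _) ⟨d + 1, fun x =>
      totalDegree_loopVec_dot_le l (grad_loop_le x) (grad_par_le x)⟩)
    (sum_mem fun μ _ => mul_mem (const_mem_boundedDegree _) ⟨d + 1, fun x =>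
      totalDegree_basisVec_dot_le μ (grad_loop_le x) (grad_par_le x)⟩)

theorem divergence_mem_boundedDegree (i : ι) (v : Vec ι n) :
    (fun D => divergence D i v) ∈ boundedDegree ℂ (ScalarVar ι n) ℂ :=
  ⟨∑ l, (v.loop l).totalDegree + ∑ μ, (v.par μ).totalDegree, fun D =>
    totalDegree_divergence_le D i
      (fun l => le_add_right (Finset.single_le_sum (f := fun l => (v.loop l).totalDegree)
        (fun _ _ => Nat.zero_le _) (Finset.mem_univ l)))
      fun μ => le_add_left (Finset.single_le_sum (f := fun μ => (v.par μ).totalDegree)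
        (fun _ _ => Nat.zero_le _) (Finset.mem_univ μ))⟩

theorem FeynmanIntegrand.numeratorAt_mem_boundedDegree {L E P n : ℕ}
    (F : FeynmanIntegrand L E P n) (S : Finset (Fin L)) (k : Fin L → Mink n) :
    F.numeratorAt S k ∈ boundedDegree ℂ (ScalarVar S n) ℂ := by
  unfold FeynmanIntegrand.numeratorAt
  generalize F.numerator = N
  induction N using MvPolynomial.induction_on with
  | C r => exact ⟨0, fun D => by simp [algebraMap_eq]⟩
  | add p q hp hq =>
    simp only [map_add]
    exact add_mem hp hq
  | mul_X p x hp =>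
    simp only [map_mul, map_X, aeval_X]
    exact mul_mem hp (const_mem_boundedDegree _)

end BoundedDegree

theorem meromorphicNFOn_zero : MeromorphicNFOn (0 : ℂ → ℂ) Set.univ :=
  fun _ _ => Or.inl (Filter.EventuallyEq.refl _ _)

theorem eq_zero_of_meromorphicNFOn {G : ℂ → ℂ} (hG : MeromorphicNFOn G Set.univ) {c : ℝ}
    (h : ∀ D : ℂ, D.re < c → G D = 0) : G = 0 := by
  have eventually_zero : ∀ᶠ z in nhds ((c - 1 : ℝ) : ℂ), G z = 0 := by
    have isOpen : IsOpen {z : ℂ | z.re < c} := isOpen_lt Complex.continuous_re continuous_const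
    exact Filter.eventually_of_mem (isOpen.mem_nhds (by simp)) h
  have order_eq_top : meromorphicOrderAt G ((c - 1 : ℝ) : ℂ) = ⊤ :=
    meromorphicOrderAt_eq_top_iff.mpr (eventually_zero.filter_mono nhdsWithin_le_nhds)
  funext z
  have order_eq_top_at : meromorphicOrderAt G z = ⊤ := by
    by_contra ne_top
    exact hG.meromorphicOn.meromorphicOrderAt_ne_top_of_isPreconnected
      isPreconnected_univ (Set.mem_univ z) (Set.mem_univ _) ne_top order_eq_top
  have nhds_iff := (hG (Set.mem_univ z)).eventuallyEq_nhdsNE_iff_eventuallyEq_nhds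
    (meromorphicNFOn_zero (Set.mem_univ z))
  exact (nhds_iff.mp (meromorphicOrderAt_eq_top_iff.mp order_eq_top_at)).self_of_nhds

namespace Propagators

open MeasureTheory

variable {ι : Type} [Fintype ι] [DecidableEq ι] {P n : ℕ} (Φ : Propagators ι P n)

theorem exists_totalDegree_fullNumerator_le (ε : ℝ) (i : ι) (v : Vec ι n) {N : ℂ → Scalar ι n}
    (hN : N ∈ boundedDegree ℂ (ScalarVar ι n) ℂ) (ν : Fin P → ℤ) :
    ∃ d, ∀ o D, (Φ.fullNumerator ε (termExponent ν o)
      (Φ.termNumerator ε D i v (N D) ν o)).totalDegree ≤ d := by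
  have termNumerator_mem (o : Option (Fin P)) :
      (fun D => Φ.termNumerator ε D i v (N D) ν o) ∈ boundedDegree ℂ (ScalarVar ι n) ℂ := by
    rcases o with _ | j
    · exact add_mem (mul_mem (divergence_mem_boundedDegree i v) hN)
        (dirDeriv_mem_boundedDegree i v hN)
    · exact neg_mem (mul_mem (mul_mem (const_mem_boundedDegree _) hN)
        (const_mem_boundedDegree _))
  choose d hd using fun o => mul_mem (termNumerator_mem o)
    (const_mem_boundedDegree (∏ j, Φ.numeratorFactor ε (termExponent ν o) j))
  exact ⟨∑ o, d o, fun o D => (hd o D).trans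
    (Finset.single_le_sum (fun _ _ => Nat.zero_le _) (Finset.mem_univ o))⟩

theorem exists_forall_sum_totalDeriv_eq_zero {ε : ℝ} (hε : 0 < ε) (i : ι) (v : Vec ι n)
    {N : ℂ → Scalar ι n} (hN : N ∈ boundedDegree ℂ (ScalarVar ι n) ℂ) (ν : Fin P → ℤ) :
    ∃ c : ℝ, ∀ D : ℂ, D.re < c →
      (∀ ν' ∈ (Φ.totalDeriv ε D i v (N D) ν).support, IntegrableOn
        (Φ.schwinger ε D ν' (Φ.totalDeriv ε D i v (N D) ν ν')) {α | ∀ j, 0 < α j}) ∧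
      ((Φ.totalDeriv ε D i v (N D) ν).sum fun ν' N' =>
        ∫ α in {α | ∀ j, 0 < α j}, Φ.schwinger ε D ν' N' α) = 0 := by
  obtain ⟨d, hd⟩ := Φ.exists_totalDegree_fullNumerator_le ε i v hN ν
  refine ⟨-(6 * d), fun D hD => ?_⟩
  simp only [totalDeriv_eq_mapDomain]
  constructor
  · intro ν' hν'
    obtain ⟨o, -, rfl⟩ := Finset.mem_image.mp (Finsupp.mapDomain_support hν')
    rw [Finsupp.mapDomain_apply (termExponent_injective ν)]
    exact Φ.integrableOn_schwinger hε (hd o D) hD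
  · rw [Finsupp.sum_mapDomain_index_inj (termExponent_injective ν), Finsupp.sum_fintype]
    · exact Φ.sum_setIntegral_schwinger_termNumerator hε i v (fun o => hd o D) hD
    · simp only [schwinger_zero, integral_zero, implies_true]

end Propagators

end DimReg

end

open DimReg in
theorem mainTheorem3_general {ι : Type} [Fintype ι] [DecidableEq ι] {P n : ℕ}
    (Φ : Propagators ι P n) (i : ι) (v : Vec ι n) {N : ℂ → Scalar ι n}
    (hN : N ∈ boundedDegree ℂ (ScalarVar ι n) ℂ) (ν : Fin P → ℤ) {ε : ℝ} (hε : 0 < ε)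
    (G : ℂ → ℂ) :
    Φ.IsDimRegIntegral ε (fun D => Φ.totalDeriv ε D i v (N D) ν) G ↔ G = 0 := by
  obtain ⟨c, hc⟩ := Φ.exists_forall_sum_totalDeriv_eq_zero hε i v hN ν
  constructor
  · rintro ⟨hG, c', hc'⟩
    refine eq_zero_of_meromorphicNFOn hG (c := min c c') fun D hD => ?_
    rw [(hc' D (hD.trans_le (min_le_right c c'))).2, (hc D (hD.trans_le (min_le_left c c'))).2]
  · rintro rfl
    exact ⟨meromorphicNFOn_zero, c, fun D hD => ⟨(hc D hD).1, (hc D hD).2.symm⟩⟩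

/-- The dimensionally regulated integral of `∂/∂k_i^μ [v^μ F]` over the loop momenta in any set
`S` containing `i` (in particular `S = {i}`, or all of them) vanishes: the zero function is its
dimensionally regulated integral, and the only one. -/
theorem mainTheorem3 {L E P n : ℕ} (F : DimReg.FeynmanIntegrand L E P n)
    (S : Finset (Fin L)) (i : Fin L) (hi : i ∈ S) (k : Fin L → DimReg.Mink n)
    (v : DimReg.Vec S n) (ε : ℝ) (hε : 0 < ε) (G : ℂ → ℂ) :
    (F.propagators S k).IsDimRegIntegral ε
      (fun D => (F.propagators S k).totalDeriv ε D ⟨i, hi⟩ v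
        (F.numeratorAt S k D) F.exponent) G ↔ G = 0 :=
  mainTheorem3_general (F.propagators S k) ⟨i, hi⟩ v (F.numeratorAt_mem_boundedDegree S k)
    F.exponent hε G
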